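/- Let $\omega$ be a non-principal ultrafilter on $\mathbb N$, let $(X_i,d_i,e_i)_{i\in\mathbb N}$ be a sequence of pointed metric spaces, and let $p\in[1,\infty)$. Let $X^\omega=\prod_\omega X_i$ be the ultraproduct with its hyperreal-valued metric $d^\omega$, let $X^\omega_{\lim}$ be the set of points at limited distance from $[(e_i)]$, let $\hat X=X^\omega_{\lim}/\{d^\omega\approx 0\}$ be the metric ultralimit with the metric $\hat d=st\circ d^\omega$, and let $st_{\hat d}:X^\omega_{\lim}\to\hat X$ be the quotient map. For a metric space $Y$, let $\mathcal P_p(Y)$ be the set of Radon probability measures on $Y$ with finite $p$-th moment, with the $p$-Wasserstein distance $W_p$. Let $\mathcal P_p(X)^\omega=\prod_\omega\mathcal P_p(X_i)$, with the hyperreal-valued distance $W_p^\omega=[(W_p)]$. For $\mu^\omega=[(\mu_i)]\in\mathcal P_p(X)^\omega$, the Loeb measure $\mu_L$ is the measure on $X^\omega$ which the Carathéodory construction yields from the premeasure $\prod_\omega B_i\mapsto st[(\mu_i(B_i))]$ on the algebra of internal Borel sets ($B_i\subseteq X_i$ Borel); it is defined on the Loeb $\sigma$-algebra of all Carathéodory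 measurable sets. Call $\mu^\omega$ a lifting of $\mu\in\mathcal P_p(\hat X)$ if $W_p^\omega(\mu^\omega,[(\delta_{e_i})])$ is limited and the class of $\mu^\omega$ modulo the relation $W_p^\omega\approx 0$ is $\iota(\mu)$. Here $\iota$ is the canonical isometric embedding of $\mathcal P_p(\hat X)$ into the metric ultralimit of the spaces $(\mathcal P_p(X_i),W_p,\delta_{e_i})$: it maps $\frac1N\sum_{j=1}^N\delta_{st_{\hat d}[(x_{j,i})_i]}$ to the class of $\big[\big(\frac1N\sum_{j=1}^N\delta_{x_{j,i}}\big)_i\big]$ and is extended to all of $\mathcal P_p(\hat X)$ by density. **Theorem.** For every $\mu\in\mathcal P_p(\hat X)$ there is $\mu^\omega\in\mathcal P_p(X)^\omega$ such that 1. $\mu^\omega$ is hyperfinite, that is, $\mu^\omega=[(\mu_i)]$ where every $\mu_i$ is finitely supported; 2. $\mu^\omega$ is a lifting of $\mu$; 3. the Loeb measure $\mu_L$ of $\mu^\omega$ is concentrated on $X^\omega_{\lim}$, i.e. $\mu_L(X^\omega\setminus X^\omega_{\lim})=0$, the map $st_{\hat d}$ is measurable from $X^\omega_{\lim}$ with the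 Loeb $\sigma$-algebra to $\hat X$ with the Borel $\sigma$-algebra, and $\mu_L\circ st_{\hat d}^{-1}=\mu$. In particular, every $\mu\in\mathcal P_p(\hat X)$ is the $st_{\hat d}$-pushforward of a Loeb measure on $X^\omega_{\lim}$. -/

import Mathlib

open MeasureTheory Filter
open scoped ENNReal

noncomputable section

namespace UltraWasserstein

/-! ### Ultraproducts, hyperreals, and standard parts -/

/-- The hyperreals `ℝ^ω` built from the ultrafilter `ω`. -/
abbrev HyperReal (ω : Ultrafilter ℕ) : Type := Germ (ω : Filter ℕ) ℝ

/-- The set-theoretic ultraproduct `X^ω` of a sequence `(X i)`. -/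
def UltraProd (ω : Ultrafilter ℕ) (X : ℕ → Type*) : Type _ := (ω : Filter ℕ).Product X

section Ultraproducts

variable {ω : Ultrafilter ℕ} {X Y : ℕ → Type*}

/-- The class `[(x i)]` of a sequence in the ultraproduct. -/
def UltraProd.mk (ω : Ultrafilter ℕ) (x : ∀ i, X i) : UltraProd ω X :=
  Quotient.mk (productSetoid (ω : Filter ℕ) X) x

/-- The ultraproduct `f^ω : X^ω → Y^ω → ℝ^ω` of real valued functions of two variables. -/
def ultraFun₂ (ω : Ultrafilter ℕ) (f : ∀ i, X i → Y i → ℝ) (x : UltraProd ω X)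
    (y : UltraProd ω Y) : HyperReal ω :=
  Quotient.liftOn₂ (s₁ := productSetoid (ω : Filter ℕ) X) (s₂ := productSetoid (ω : Filter ℕ) Y)
    x y (fun a b => ((fun i => f i (a i) (b i) : ℕ → ℝ) : HyperReal ω)) (by
      intro a b a' b' h h'
      apply Germ.coe_eq.2
      filter_upwards [h, h'] with i hi hi'
      rw [hi, hi'])

/-- The standard part of a hyperreal: the real number infinitely close to it
(the value is only meaningful for limited hyperreals). -/
def st (x : HyperReal ω) : ℝ := ArchimedeanClass.stdPart x

/-- The embedding of the reals into the hyperreals, as an ordered ring homomorphism. -/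
def realHom (ω : Ultrafilter ℕ) : ℝ →+*o HyperReal ω where
  toFun r := ((r : ℝ) : HyperReal ω)
  map_one' := rfl
  map_mul' _ _ := rfl
  map_zero' := rfl
  map_add' _ _ := rfl
  monotone' _ _ h := Germ.const_le h

theorem finite_of_le {x : HyperReal ω} {r : ℝ} (h0 : 0 ≤ x) (hr : x ≤ (r : HyperReal ω)) :
    0 ≤ ArchimedeanClass.mk x :=
  ArchimedeanClass.mk_nonneg_of_le_of_le_of_archimedean (realHom ω) (r := 0) (s := r)
    (by simpa using h0) hr

end Ultraproducts

/-! ### The metric ultralimit -/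

section Metric

variable {X : ℕ → Type*} [∀ i, MetricSpace (X i)]

/-- The hyperreal valued metric `d^ω` on `X^ω`. -/
def ultraDist (ω : Ultrafilter ℕ) (x y : UltraProd ω X) : HyperReal ω :=
  ultraFun₂ ω (fun i (a b : X i) => dist a b) x y

theorem ultraDist_nonneg (ω : Ultrafilter ℕ) (x y : UltraProd ω X) : 0 ≤ ultraDist ω x y := by
  induction x using Quotient.inductionOn
  induction y using Quotient.inductionOn
  exact Germ.coe_le.2 (Eventually.of_forall fun i => dist_nonneg)

theorem ultraDist_self (ω : Ultrafilter ℕ) (x : UltraProd ω X) : ultraDist ω x x = 0 := by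
  induction x using Quotient.inductionOn
  exact Germ.coe_eq.2 (Eventually.of_forall fun i => dist_self _)

theorem ultraDist_comm (ω : Ultrafilter ℕ) (x y : UltraProd ω X) :
    ultraDist ω x y = ultraDist ω y x := by
  induction x using Quotient.inductionOn
  induction y using Quotient.inductionOn
  exact Germ.coe_eq.2 (Eventually.of_forall fun i => dist_comm _ _)

theorem ultraDist_triangle (ω : Ultrafilter ℕ) (x y z : UltraProd ω X) :
    ultraDist ω x z ≤ ultraDist ω x y + ultraDist ω y z := by
  induction x using Quotient.inductionOn
  induction y using Quotient.inductionOn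
  induction z using Quotient.inductionOn
  exact Germ.coe_le.2 (Eventually.of_forall fun i => dist_triangle _ _ _)

variable (ω : Ultrafilter ℕ) (e : ∀ i, X i)

/-- The limited part `X^ω_lim ⊆ X^ω`: the points at limited distance from `[(e i)]`. -/
def limitedSet : Set (UltraProd ω X) :=
  {x | ∃ r : ℝ, ultraDist ω (UltraProd.mk ω e) x ≤ (r : HyperReal ω)}

/-- `X^ω_lim` as a type. -/
def Limited : Type _ := {x : UltraProd ω X // x ∈ limitedSet ω e}

theorem Limited.finite_dist (x y : Limited ω e) :
    0 ≤ ArchimedeanClass.mk (ultraDist ω x.1 y.1) := by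
  obtain ⟨r, hr⟩ := x.2
  obtain ⟨s, hs⟩ := y.2
  refine finite_of_le (r := r + s) (ultraDist_nonneg ω _ _) ?_
  calc ultraDist ω x.1 y.1
      ≤ ultraDist ω x.1 (UltraProd.mk ω e) + ultraDist ω (UltraProd.mk ω e) y.1 :=
        ultraDist_triangle ω _ _ _
    _ ≤ (r : HyperReal ω) + (s : HyperReal ω) := by
        rw [ultraDist_comm ω x.1]
        exact add_le_add hr hs
    _ = ((r + s : ℝ) : HyperReal ω) := rfl

/-- `X^ω_lim` with the real valued pseudometric `st ∘ d^ω`. -/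
instance Limited.instPseudoMetricSpace : PseudoMetricSpace (Limited ω e) where
  dist x y := st (ultraDist ω x.1 y.1)
  dist_self x := by
    change ArchimedeanClass.stdPart _ = 0
    rw [ultraDist_self, ArchimedeanClass.stdPart_zero]
  dist_comm x y := by
    change ArchimedeanClass.stdPart _ = ArchimedeanClass.stdPart _
    rw [ultraDist_comm]
  dist_triangle x y z := by
    change ArchimedeanClass.stdPart _ ≤ ArchimedeanClass.stdPart _ + ArchimedeanClass.stdPart _
    have hxy := Limited.finite_dist ω e x y
    have hyz := Limited.finite_dist ω e y z
    rw [← ArchimedeanClass.stdPart_add hxy hyz]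
    refine ArchimedeanClass.stdPart_monotoneOn (Limited.finite_dist ω e x z) ?_
      (ultraDist_triangle ω _ _ _)
    exact (le_min hxy hyz).trans (ArchimedeanClass.min_le_mk_add _ _)

/-- The metric ultralimit `X̂`: the quotient of `X^ω_lim` by the relation `d^ω(x, y) ≈ 0`, with the
quotient metric `d̂([x], [y]) = st (d^ω(x, y))`. -/
def UltraLimit : Type _ := SeparationQuotient (Limited ω e)

instance : MetricSpace (UltraLimit ω e) :=
  inferInstanceAs (MetricSpace (SeparationQuotient (Limited ω e)))

instance : MeasurableSpace (UltraLimit ω e) := borel _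

instance : BorelSpace (UltraLimit ω e) := ⟨rfl⟩

variable {ω e}

/-- The standard part map `st_d̂ : X^ω_lim → X̂`. -/
def stHat (x : Limited ω e) : UltraLimit ω e := SeparationQuotient.mk x

theorem dist_stHat (x y : Limited ω e) :
    dist (stHat x) (stHat y) = st (ultraDist ω x.1 y.1) := rfl

end Metric

/-! ### Wasserstein spaces -/

section Wasserstein

variable {X : Type*} [MetricSpace X] [MeasurableSpace X] [BorelSpace X]

/-- `IsCoupling μ ν γ`: the Borel measure `γ` on `X × X` has marginals `μ` and `ν`. The product
carries the Borel `σ`-algebra of the product topology, for which the distance is measurable also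
when `X` is not separable. -/
def IsCoupling (μ ν : Measure X) (γ : @Measure (X × X) (borel (X × X))) : Prop :=
  @Measure.map (X × X) X (borel (X × X)) _ Prod.fst γ = μ ∧
    @Measure.map (X × X) X (borel (X × X)) _ Prod.snd γ = ν

/-- The `p`-Wasserstein distance
`W_p(μ, ν) = (inf_γ ∫ d(x, y)^p dγ(x, y))^(1/p)`, the infimum being over all couplings. -/
def wassersteinDist (p : ℝ) (μ ν : Measure X) : ℝ :=
  ((⨅ (γ : @Measure (X × X) (borel (X × X))) (_ : IsCoupling μ ν γ),
    @lintegral (X × X) (borel (X × X)) γ fun z => edist z.1 z.2 ^ p) ^ (1 / p)).toReal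

variable (X) (p : ℝ)

/-- The space `P_p(X)` of Radon probability measures on `X` with finite `p`-th moment. -/
structure WassersteinSpace where
  /-- the underlying Borel measure -/
  toMeasure : Measure X
  isProbabilityMeasure : IsProbabilityMeasure toMeasure
  innerRegular : toMeasure.InnerRegular
  finite_moment : ∃ x₀ : X, ∫⁻ x, edist x x₀ ^ p ∂toMeasure < ∞

variable {X}

/-- The uniform discrete measure `(1/N) ∑ⱼ δ_{xⱼ}` on `N` (not necessarily distinct) points. -/
def cloudMeasure {N : ℕ} (x : Fin N → X) : Measure X :=
  (N : ℝ≥0∞)⁻¹ • ∑ j, Measure.dirac (x j)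

theorem innerRegular_dirac (x : X) : (Measure.dirac x).InnerRegular := by
  refine ⟨fun s hs r hr => ?_⟩
  by_cases hx : x ∈ s
  · refine ⟨{x}, by simpa using hx, isCompact_singleton, ?_⟩
    rw [Measure.dirac_apply' x hs] at hr
    rw [Measure.dirac_apply' x (measurableSet_singleton x)]
    simpa [hx] using hr
  · rw [Measure.dirac_apply' x hs] at hr
    simp [hx] at hr

/-- `(1/N) ∑ⱼ δ_{xⱼ}` as an element of `P_p(X)`. -/
def cloud (hp : 1 ≤ p) {N : ℕ} [NeZero N] (x : Fin N → X) : WassersteinSpace X p where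
  toMeasure := cloudMeasure x
  isProbabilityMeasure := by
    refine ⟨?_⟩
    simp only [cloudMeasure, Measure.smul_apply, Measure.coe_finsetSum, Finset.sum_apply,
      measure_univ, Finset.sum_const, Finset.card_univ, Fintype.card_fin, smul_eq_mul,
      nsmul_eq_mul, mul_one]
    exact ENNReal.inv_mul_cancel (by simpa using NeZero.ne N) (by simp)
  innerRegular := by
    have : ∀ j, (Measure.dirac (x j)).InnerRegular := fun j => innerRegular_dirac (x j)
    unfold cloudMeasure
    infer_instance
  finite_moment := by
    refine ⟨x 0, ?_⟩
    simp only [cloudMeasure, lintegral_smul_measure, lintegral_finsetSum_measure,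
      lintegral_dirac, smul_eq_mul]
    refine ENNReal.mul_lt_top (by simpa using NeZero.pos N) (ENNReal.sum_lt_top.2 fun j _ => ?_)
    exact ENNReal.rpow_lt_top_of_nonneg (by linarith) (edist_ne_top _ _)

end Wasserstein

/-! ### Loeb measures -/

section Loeb

variable {ω : Ultrafilter ℕ} {X : ℕ → Type*}

/-- The internal subset `∏_ω B i` of `X^ω`: the set of `[(x i)]` with `x i ∈ B i` for `ω`-almost
all `i`. -/
def internalSet (ω : Ultrafilter ℕ) (B : ∀ i, Set (X i)) : Set (UltraProd ω X) :=
  {x | ∃ a : ∀ i, X i, UltraProd.mk ω a = x ∧ ∀ᶠ i in (ω : Filter ℕ), a i ∈ B i}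

theorem mk_mem_internalSet {B : ∀ i, Set (X i)} {a : ∀ i, X i} :
    UltraProd.mk ω a ∈ internalSet ω B ↔ ∀ᶠ i in (ω : Filter ℕ), a i ∈ B i := by
  refine ⟨?_, fun h => ⟨a, rfl, h⟩⟩
  rintro ⟨b, hb, h⟩
  have hab : ∀ᶠ i in (ω : Filter ℕ), b i = a i :=
    Quotient.exact (s := productSetoid (ω : Filter ℕ) X) hb
  filter_upwards [h, hab] with i hi hi'
  rwa [← hi']

theorem internalSet_congr (e : ∀ i, X i) {B C : ∀ i, Set (X i)}
    (h : internalSet ω B = internalSet ω C) : ∀ᶠ i in (ω : Filter ℕ), B i = C i := by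
  classical
  by_contra hne
  rw [← Ultrafilter.eventually_not] at hne
  have key : ∀ i, ∃ x : X i, B i ≠ C i → ¬ (x ∈ B i ↔ x ∈ C i) := by
    intro i
    by_cases hi : B i = C i
    · exact ⟨e i, fun h => absurd hi h⟩
    · by_contra hcon
      push Not at hcon
      exact hi (Set.ext fun x => (hcon x).2)
  choose a ha using key
  have h1 : (∀ᶠ i in (ω : Filter ℕ), a i ∈ B i) ↔ ∀ᶠ i in (ω : Filter ℕ), a i ∈ C i := by
    rw [← mk_mem_internalSet, ← mk_mem_internalSet, h]
  have h2 : ∀ᶠ i in (ω : Filter ℕ), ¬ (a i ∈ B i ↔ a i ∈ C i) := hne.mono fun i hi => ha i hi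
  by_cases hB : ∀ᶠ i in (ω : Filter ℕ), a i ∈ B i
  · obtain ⟨i, h3, h4, h5⟩ := (h2.and (hB.and (h1.1 hB))).exists
    exact h3 ⟨fun _ => h5, fun _ => h4⟩
  · have hC : ¬ ∀ᶠ i in (ω : Filter ℕ), a i ∈ C i := fun h => hB (h1.2 h)
    rw [← Ultrafilter.eventually_not] at hB hC
    obtain ⟨i, h3, h4, h5⟩ := (h2.and (hB.and hC)).exists
    exact h3 ⟨fun h => absurd h h4, fun h => absurd h h5⟩

variable [∀ i, MetricSpace (X i)] [∀ i, MeasurableSpace (X i)] [∀ i, BorelSpace (X i)] {p : ℝ}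

variable (X p ω) in
/-- The ultraproduct `P_p(X)^ω`, whose elements are internal probability measures `[(μ i)]`. -/
abbrev InternalMeasure : Type _ := UltraProd ω fun i => WassersteinSpace (X i) p

/-- The hyperreal `μ^ω(∏_ω B i) = [(μ i (B i))]`. -/
def internalValue (μω : InternalMeasure ω X p) (B : ∀ i, Set (X i)) : HyperReal ω :=
  ultraFun₂ ω (fun i (μ : WassersteinSpace (X i) p) (S : Set (X i)) => μ.toMeasure.real S)
    μω (UltraProd.mk ω B)

/-- The premeasure `st ∘ μ^ω` on the algebra of internal Borel sets `∏_ω B i`, extended by `∞` to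
all other subsets of `X^ω`. For an internal Borel set the infimum is over a nonempty family of
equal values, see `loebPremeasure_internalSet`. -/
def loebPremeasure (μω : InternalMeasure ω X p) (S : Set (UltraProd ω X)) : ℝ≥0∞ :=
  ⨅ (B : ∀ i, Set (X i)) (_ : ∀ i, MeasurableSet (B i)) (_ : internalSet ω B = S),
    ENNReal.ofReal (st (internalValue μω B))

theorem loebPremeasure_internalSet (e : ∀ i, X i) (μω : InternalMeasure ω X p)
    {B : ∀ i, Set (X i)} (hB : ∀ i, MeasurableSet (B i)) :
    loebPremeasure μω (internalSet ω B) = ENNReal.ofReal (st (internalValue μω B)) := by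
  refine le_antisymm (iInf_le_of_le B (iInf_le_of_le hB (iInf_le_of_le rfl le_rfl))) ?_
  refine le_iInf fun C => le_iInf fun _ => le_iInf fun hCB => ?_
  have : UltraProd.mk ω C = UltraProd.mk ω B :=
    Quotient.sound (s := productSetoid (ω : Filter ℕ) fun i => Set (X i))
      (internalSet_congr e hCB)
  simp only [internalValue, this, le_refl]

theorem loebPremeasure_empty (μω : InternalMeasure ω X p) : loebPremeasure μω ∅ = 0 := by
  refine le_antisymm ?_ zero_le
  refine iInf_le_of_le (fun _ => ∅) (iInf_le_of_le (fun _ => MeasurableSet.empty)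
    (iInf_le_of_le ?_ ?_))
  · refine Set.eq_empty_of_forall_notMem ?_
    rintro x ⟨a, _, ha⟩
    exact ha.exists.choose_spec
  · have : internalValue μω (fun _ => ∅) = 0 := by
      induction μω using Quotient.inductionOn
      exact Germ.coe_eq.2 (Eventually.of_forall fun i => by simp)
    simp [this, st]

/-- The Carathéodory outer measure induced by the premeasure `st ∘ μ^ω`. -/
def loebOuterMeasure (μω : InternalMeasure ω X p) : OuterMeasure (UltraProd ω X) :=
  OuterMeasure.ofFunction (loebPremeasure μω) (loebPremeasure_empty μω)

/-- The Loeb `σ`-algebra on `X^ω`: the Carathéodory measurable sets. -/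
@[reducible]
def loebSpace (μω : InternalMeasure ω X p) : MeasurableSpace (UltraProd ω X) :=
  (loebOuterMeasure μω).caratheodory

/-- The Loeb measure `μ_L = Loeb(μ^ω)` on `X^ω`. -/
def loebMeasure (μω : InternalMeasure ω X p) : @Measure (UltraProd ω X) (loebSpace μω) :=
  @OuterMeasure.toMeasure _ (loebSpace μω) (loebOuterMeasure μω) le_rfl

/-- The trace of the Loeb `σ`-algebra on `X^ω_lim`. -/
@[reducible]
def loebSpaceLim (e : ∀ i, X i) (μω : InternalMeasure ω X p) : MeasurableSpace (Limited ω e) :=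
  (loebSpace μω).comap Subtype.val

/-- The Loeb measure `μ_L` on `X^ω_lim` (restriction of the Loeb measure on `X^ω`). -/
def loebMeasureLim (e : ∀ i, X i) (μω : InternalMeasure ω X p) :
    @Measure (Limited ω e) (loebSpaceLim e μω) :=
  @Measure.comap _ _ (loebSpaceLim e μω) (loebSpace μω) Subtype.val (loebMeasure μω)

/-! ### Hyperfinite measures and liftings -/

/-- `μ^ω` is hyperfinite: an ultraproduct of finitely supported measures. -/
def IsHyperfinite (μω : InternalMeasure ω X p) : Prop :=
  ∃ ν : ∀ i, WassersteinSpace (X i) p, UltraProd.mk ω ν = μω ∧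
    ∀ i, ∃ S : Finset (X i), (ν i).toMeasure (S : Set (X i))ᶜ = 0

/-- The hyperreal valued distance `W_p^ω` on `P_p(X)^ω`. -/
def ultraWasserstein (μω νω : InternalMeasure ω X p) : HyperReal ω :=
  ultraFun₂ ω (fun i (μ ν : WassersteinSpace (X i) p) =>
    wassersteinDist p μ.toMeasure ν.toMeasure) μω νω

/-- The base point `[(δ_{e i})]` of `P_p(X)^ω`. -/
def diracBase (ω : Ultrafilter ℕ) (hp : 1 ≤ p) (e : ∀ i, X i) : InternalMeasure ω X p :=
  UltraProd.mk ω fun i => cloud p hp (N := 1) fun _ => e i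

/-- `ν = (1/N) ∑ⱼ δ_{x̂ⱼ}` is a discrete measure on `X̂` and `ν^ω = [((1/N) ∑ⱼ δ_{x_{j,i}})_i]` where
`x̂ⱼ = st_d̂ [(x_{j,i})_i]`. In this case `ι ν = st_Ŵp(ν^ω)` for the canonical isometric
embedding `ι` of `P_p(X̂)` into the metric ultralimit of the spaces `P_p(X i)`. -/
def IsDiscreteLift (hp : 1 ≤ p) (e : ∀ i, X i) (νω : InternalMeasure ω X p)
    (ν : WassersteinSpace (UltraLimit ω e) p) : Prop :=
  ∃ (N : ℕ) (_ : NeZero N) (x : Fin N → ∀ i, X i)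
    (hx : ∀ j, UltraProd.mk ω (x j) ∈ limitedSet ω e),
    ν = cloud p hp (fun j => stHat (⟨UltraProd.mk ω (x j), hx j⟩ : Limited ω e)) ∧
    νω = UltraProd.mk ω fun i => cloud p hp fun j => x j i

/-- `μ^ω` is a lifting of `μ`: it lies in `P_p(X)^ω_lim` and `st_Ŵp(μ^ω) = ι μ`. Here `ι` is the
canonical isometric embedding, prescribed by `IsDiscreteLift` on the discrete measures
`(1/N) ∑ⱼ δ_{x̂ⱼ}` and extended by density. So the condition says that `μ` is a `W_p`-limit
of such measures, and that `ι ν → st_Ŵp(μ^ω)` as `ν → μ` through such measures. -/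
structure IsLifting (hp : 1 ≤ p) (e : ∀ i, X i) (μω : InternalMeasure ω X p)
    (μ : WassersteinSpace (UltraLimit ω e) p) : Prop where
  limited : ∃ r : ℝ, ultraWasserstein μω (diracBase ω hp e) ≤ (r : HyperReal ω)
  dense : ∀ δ : ℝ, 0 < δ → ∃ νω ν, IsDiscreteLift hp e νω ν ∧
    wassersteinDist p μ.toMeasure ν.toMeasure < δ
  tendsto : ∀ ε : ℝ, 0 < ε → ∃ δ : ℝ, 0 < δ ∧ ∀ νω ν, IsDiscreteLift hp e νω ν →
    wassersteinDist p μ.toMeasure ν.toMeasure < δ →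
    ultraWasserstein μω νω < (ε : HyperReal ω)

end Loeb

end UltraWasserstein

end

noncomputable section

namespace UltraWasserstein

/-! ### Transport plans between a measure and a cloud -/

section Transport

variable {X : Type*} [MetricSpace X] [MeasurableSpace X] [BorelSpace X] {p : ℝ}

/-! A cloud is a uniform measure on finitely many points, possibly repeated. Clouds are dense in
`P_p(X̂)`: a Radon measure lives on a σ-compact set, so it is close to its image under a simple
function, whose weights can be rounded to multiples of `1/n`.

Let clouds `s n` converge to `μ`, and lift their points to sequences, giving clouds `x n` in the
factors. By `Represents.tendsto_dist` the distances in the factors converge along `ω` to those in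
`X̂`. Hence a fixed transport matrix between two clouds of `X̂` has nearly the same cost between
their lifts in almost every factor (`eventually_matrix_lt`). The matrix itself comes from
`exists_matrix`, the triangle inequality through `μ`. So the lifts are Cauchy, and since `ω` is
non-principal a diagonal sequence `x (k i)` is infinitely close to their limit. Its class is the
hyperfinite lifting.

For the pushforward, countable saturation shows that the Loeb measure extends its premeasure. If `K`
is compact, `st⁻¹(K)` is a decreasing intersection of internal thickenings of finite nets. Markov's
inequality for transport plans bounds the premeasure of each thickening below by `μ(K)`, so `μ(K) ≤
μ_L(st⁻¹(K))`. Inner regularity extends this bound to internal approximations of `A` and `Aᶜ` for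
Borel `A`. Both measures have mass one, so equality holds, and completeness of the Loeb space makes
`st⁻¹(A)` measurable. The case `A = X̂` is concentration on the limited part. -/

open scoped Classical in
/-- A coupling of a measure with a cloud splits the measure into equally heavy pieces, one for
each point of the cloud, at the same transport cost. -/
theorem exists_split_of_coupling {T : Type*} [MeasurableSpace T] (γ : Measure T) {f g : T → X}
    (hf : Measurable f) (hg : Measurable g) {M : ℕ} (y : Fin M → X)
    (hy : γ.map g = cloudMeasure y) :
    ∃ m : Fin M → Measure X, ∑ j, m j = γ.map f ∧ (∀ j, m j Set.univ = (M : ℝ≥0∞)⁻¹) ∧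
      ∑ j, ∫⁻ z, edist z (y j) ^ p ∂(m j) = ∫⁻ t, edist (f t) (g t) ^ p ∂γ := by
  -- Points of the cloud may coincide: the mass over `y j` is `c j / M`, shared equally among the `c
  -- j` indices that carry this point.
  set c : Fin M → ℝ≥0∞ := fun j => ((Finset.univ.filter fun k => y k = y j).card : ℝ≥0∞) with hc
  have hc0 : ∀ j, c j ≠ 0 := fun j => by
    simp only [hc, ne_eq, Nat.cast_eq_zero, Finset.card_eq_zero]
    exact Finset.Nonempty.ne_empty ⟨j, by simp⟩
  have hct : ∀ j, c j ≠ ∞ := fun j => ENNReal.natCast_ne_top _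
  have hms : ∀ j, MeasurableSet (g ⁻¹' {y j}) := fun j => hg (measurableSet_singleton _)
  set w : Fin M → T → ℝ≥0∞ := fun j => (g ⁻¹' {y j}).indicator fun _ => (c j)⁻¹ with hw
  have hwm : ∀ j, Measurable (w j) := fun j => measurable_const.indicator (hms j)
  have hrange : ∀ᵐ t ∂γ, g t ∈ Set.range y := by
    have hr : MeasurableSet (Set.range y) := (Set.finite_range y).measurableSet
    have h0 : γ.map g (Set.range y)ᶜ = 0 := by
      rw [hy]
      simp [cloudMeasure, Measure.dirac_apply' _ hr.compl]
    rw [Measure.map_apply hg hr.compl] at h0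
    exact h0
  have hw1 : ∀ᵐ t ∂γ, ∑ j, w j t = 1 := by
    filter_upwards [hrange] with t ht
    obtain ⟨k, hk⟩ := ht
    have : ∀ j, w j t = if y j = y k then (c k)⁻¹ else 0 := by
      intro j
      by_cases h : y j = y k
      · simp [hw, hc, h, ← hk]
      · have h' : ¬ y k = y j := fun h' => h h'.symm
        simp [hw, h, h', ← hk]
    simp only [this]
    rw [← Finset.sum_filter, Finset.sum_const, nsmul_eq_mul]
    exact ENNReal.mul_inv_cancel (hc0 k) (hct k)
  refine ⟨fun j => (γ.withDensity (w j)).map f, ?_, ?_, ?_⟩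
  · ext s hs
    simp only [Measure.coe_finsetSum, Finset.sum_apply, Measure.map_apply hf hs]
    simp only [withDensity_apply _ (hf hs)]
    rw [← lintegral_finsetSum _ fun j _ => hwm j]
    rw [lintegral_congr_ae (ae_restrict_of_ae hw1)]
    simp
  · intro j
    have h1 : γ (g ⁻¹' {y j}) = c j * (M : ℝ≥0∞)⁻¹ := by
      rw [← Measure.map_apply hg (measurableSet_singleton _), hy, cloudMeasure]
      simp [Set.indicator_apply, hc, mul_comm]
    rw [Measure.map_apply hf MeasurableSet.univ, Set.preimage_univ,
      withDensity_apply _ MeasurableSet.univ, Measure.restrict_univ,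
      lintegral_indicator_const (hms j), h1, ← mul_assoc, ENNReal.inv_mul_cancel (hc0 j) (hct j),
      one_mul]
  · have hd : ∀ j, Measurable fun z : X => edist z (y j) ^ p := fun j =>
      (measurable_edist_left).pow_const p
    have h2 : ∀ j, ∫⁻ z, edist z (y j) ^ p ∂((γ.withDensity (w j)).map f) =
        ∫⁻ t, w j t * edist (f t) (y j) ^ p ∂γ := fun j => by
      rw [lintegral_map (hd j) hf]
      exact lintegral_withDensity_eq_lintegral_mul γ (hwm j) ((hd j).comp hf)
    have hwd : ∀ j, Measurable fun t => w j t * edist (f t) (y j) ^ p := fun j =>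
      (hwm j).mul ((hd j).comp hf)
    rw [Finset.sum_congr rfl fun j _ => h2 j, ← lintegral_finsetSum _ fun j _ => hwd j]
    refine lintegral_congr_ae ?_
    filter_upwards [hw1] with t ht
    have : ∀ j, w j t * edist (f t) (y j) ^ p = w j t * edist (f t) (g t) ^ p := by
      intro j
      by_cases h : g t = y j
      · rw [h]
      · simp [hw, h]
    simp only [this]
    rw [← Finset.sum_mul, ht, one_mul]

/-- Two splittings of a probability measure along two clouds have a common refinement, which
yields a transport matrix between the clouds. -/
theorem exists_matrix_of_split (hp : 1 ≤ p) (μ : Measure X) [IsFiniteMeasure μ] {N M : ℕ}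
    (x : Fin N → X) (y : Fin M → X) (m : Fin N → Measure X) (n : Fin M → Measure X)
    (hm : ∑ j, m j = μ) (hn : ∑ k, n k = μ)
    (hm1 : ∀ j, m j Set.univ = (N : ℝ≥0∞)⁻¹) (hn1 : ∀ k, n k Set.univ = (M : ℝ≥0∞)⁻¹) :
    ∃ r : Fin N → Fin M → ℝ≥0∞, (∀ j, ∑ k, r j k = (N : ℝ≥0∞)⁻¹) ∧
      (∀ k, ∑ j, r j k = (M : ℝ≥0∞)⁻¹) ∧
      (∑ j, ∑ k, r j k * edist (x j) (y k) ^ p) ^ (1 / p) ≤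
        (∑ j, ∫⁻ z, edist z (x j) ^ p ∂(m j)) ^ (1 / p) +
        (∑ k, ∫⁻ z, edist z (y k) ^ p ∂(n k)) ^ (1 / p) := by
  -- Each piece is dominated by `μ`, so it has a Radon–Nikodym density; the densities sum to one
  -- because the pieces sum to `μ`.
  have key : ∀ {L : ℕ} (m : Fin L → Measure X), ∑ j, m j = μ →
      ∃ f : Fin L → X → ℝ≥0∞, (∀ j, Measurable (f j)) ∧ (∀ j, μ.withDensity (f j) = m j) ∧
        ∀ᵐ z ∂μ, ∑ j, f j z = 1 := by
    intro L m hm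
    have hle : ∀ j, m j ≤ μ := fun j => by
      rw [← hm]
      refine Measure.le_iff.2 fun s _ => ?_
      simp only [Measure.coe_finsetSum, Finset.sum_apply]
      exact Finset.single_le_sum (f := fun j => m j s) (fun _ _ => zero_le) (Finset.mem_univ j)
    have hfin : ∀ j, IsFiniteMeasure (m j) := fun j => isFiniteMeasure_of_le μ (hle j)
    have hf : ∀ j, μ.withDensity ((m j).rnDeriv μ) = m j := fun j =>
      Measure.withDensity_rnDeriv_eq _ _ (Measure.absolutelyContinuous_of_le (hle j))
    have hmeas : Measurable fun z => ∑ j, (m j).rnDeriv μ z :=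
      Finset.measurable_sum _ fun j _ => Measure.measurable_rnDeriv _ _
    refine ⟨fun j => (m j).rnDeriv μ, fun j => Measure.measurable_rnDeriv _ _, hf, ?_⟩
    refine (withDensity_eq_iff_of_sigmaFinite (f := fun z => ∑ j, (m j).rnDeriv μ z)
      (g := fun _ => 1) hmeas.aemeasurable aemeasurable_const).1 ?_
    ext s hs
    rw [withDensity_apply _ hs,
      lintegral_finsetSum _ fun j _ => Measure.measurable_rnDeriv _ _]
    simp only [← withDensity_apply _ hs, hf]
    rw [withDensity_apply _ hs, setLIntegral_const, one_mul]
    conv_rhs => rw [← hm]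
    simp
  obtain ⟨f, hfm, hf, hf1⟩ := key m hm
  obtain ⟨g, hgm, hg, hg1⟩ := key n hn
  have hdx : ∀ x : X, Measurable fun z : X => edist z x ^ p := fun x =>
    (measurable_edist_left).pow_const p
  -- The gluing: given `z`, the indices `j` and `k` are drawn independently with probabilities `f j
  -- z` and `g k z`. With finite index sets, densities replace a disintegration.
  set τ : Measure ((Fin N × Fin M) × X) :=
    (Measure.count.prod μ).withDensity fun q => f q.1.1 q.2 * g q.1.2 q.2 with hτ
  have hfg : ∀ j k, Measurable fun z => f j z * g k z := fun j k => (hfm j).mul (hgm k)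
  have hfgd : ∀ j k x, Measurable fun z => f j z * g k z * edist z x ^ p := fun j k x =>
    (hfg j k).mul (hdx x)
  have hWm : Measurable fun q : (Fin N × Fin M) × X => f q.1.1 q.2 * g q.1.2 q.2 :=
    measurable_from_prod_countable_right fun a => (hfm a.1).mul (hgm a.2)
  have hint : ∀ h : (Fin N × Fin M) × X → ℝ≥0∞, Measurable h →
      ∫⁻ q, h q ∂τ = ∑ j, ∑ k, ∫⁻ z, f j z * g k z * h ((j, k), z) ∂μ := by
    intro h hh
    rw [hτ, lintegral_withDensity_eq_lintegral_mul _ hWm hh,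
      lintegral_prod _ (hWm.mul hh).aemeasurable, lintegral_count, tsum_fintype,
      Fintype.sum_prod_type]
    rfl
  have hF : Measurable fun q : (Fin N × Fin M) × X => edist q.2 (x q.1.1) :=
    measurable_from_prod_countable_right fun a => measurable_edist_left (x := x a.1)
  have hG : Measurable fun q : (Fin N × Fin M) × X => edist q.2 (y q.1.2) :=
    measurable_from_prod_countable_right fun a => measurable_edist_left (x := y a.2)
  refine ⟨fun j k => ∫⁻ z, f j z * g k z ∂μ, fun j => ?_, fun k => ?_, ?_⟩
  · dsimp only
    rw [← lintegral_finsetSum _ fun k _ => hfg j k, ← hm1 j, ← hf j,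
      withDensity_apply _ MeasurableSet.univ, Measure.restrict_univ]
    refine lintegral_congr_ae ?_
    filter_upwards [hg1] with z hz
    rw [← Finset.mul_sum, hz, mul_one]
  · dsimp only
    rw [← lintegral_finsetSum _ fun j _ => hfg j k, ← hn1 k, ← hg k,
      withDensity_apply _ MeasurableSet.univ, Measure.restrict_univ]
    refine lintegral_congr_ae ?_
    filter_upwards [hf1] with z hz
    rw [← Finset.sum_mul, hz, one_mul]
  · have hx : ∫⁻ q, edist q.2 (x q.1.1) ^ p ∂τ = ∑ j, ∫⁻ z, edist z (x j) ^ p ∂(m j) := by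
      rw [hint _ (hF.pow_const p)]
      refine Finset.sum_congr rfl fun j _ => ?_
      dsimp only
      rw [← lintegral_finsetSum _ fun k _ => hfgd j k _, ← hf j,
        lintegral_withDensity_eq_lintegral_mul _ (hfm j) (hdx _)]
      refine lintegral_congr_ae ?_
      filter_upwards [hg1] with z hz
      simp only [Pi.mul_apply]
      rw [← Finset.sum_mul, ← Finset.mul_sum, hz, mul_one]
    have hy : ∫⁻ q, edist q.2 (y q.1.2) ^ p ∂τ = ∑ k, ∫⁻ z, edist z (y k) ^ p ∂(n k) := by
      rw [hint _ (hG.pow_const p), Finset.sum_comm]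
      refine Finset.sum_congr rfl fun k _ => ?_
      dsimp only
      rw [← lintegral_finsetSum _ fun j _ => hfgd j k _, ← hg k,
        lintegral_withDensity_eq_lintegral_mul _ (hgm k) (hdx _)]
      refine lintegral_congr_ae ?_
      filter_upwards [hf1] with z hz
      simp only [Pi.mul_apply]
      rw [← Finset.sum_mul, ← Finset.sum_mul, hz, one_mul]
    have hxy : ∑ j, ∑ k, (∫⁻ z, f j z * g k z ∂μ) * edist (x j) (y k) ^ p =
        ∫⁻ q, edist (x q.1.1) (y q.1.2) ^ p ∂τ := by
      rw [hint (fun q => edist (x q.1.1) (y q.1.2) ^ p)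
        (measurable_from_prod_countable_right fun a =>
          measurable_const (a := edist (x a.1) (y a.2) ^ p))]
      refine Finset.sum_congr rfl fun j _ => Finset.sum_congr rfl fun k _ => ?_
      exact (lintegral_mul_const _ (hfg j k)).symm
    rw [hxy, ← hx, ← hy]
    -- Minkowski in `L^p(τ)`; what remains is the pointwise triangle inequality through `z`.
    refine le_trans ?_ (ENNReal.lintegral_Lp_add_le hF.aemeasurable hG.aemeasurable hp)
    gcongr with q
    rw [Pi.add_apply, edist_comm q.2]
    exact edist_triangle _ _ _

/-! ### The transport cost -/

/-- The optimal transport cost, that is, the `p`-th power of the Wasserstein distance. -/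
def transportCost (p : ℝ) (μ ν : Measure X) : ℝ≥0∞ :=
  ⨅ (γ : @Measure (X × X) (borel (X × X))) (_ : IsCoupling μ ν γ),
    @lintegral (X × X) (borel (X × X)) γ fun z => edist z.1 z.2 ^ p

theorem wassersteinDist_eq (μ ν : Measure X) :
    wassersteinDist p μ ν = (transportCost p μ ν ^ (1 / p)).toReal := rfl

/-- A pair of maps to `X` gives an upper bound for the transport cost. -/
theorem transportCost_le {T : Type*} [MeasurableSpace T] (γ : Measure T) {f g : T → X}
    (h : @Measurable _ _ _ (borel (X × X)) fun t => (f t, g t)) :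
    transportCost p (γ.map f) (γ.map g) ≤ ∫⁻ t, edist (f t) (g t) ^ p ∂γ := by
  let _ : MeasurableSpace (X × X) := borel (X × X)
  have : BorelSpace (X × X) := ⟨rfl⟩
  have h1 : Measurable (Prod.fst : X × X → X) := continuous_fst.measurable
  have h2 : Measurable (Prod.snd : X × X → X) := continuous_snd.measurable
  refine iInf₂_le_of_le (γ.map fun t => (f t, g t)) ⟨?_, ?_⟩ ?_
  · exact Measure.map_map h1 h
  · exact Measure.map_map h2 h
  · refine (lintegral_map ?_ h).le
    exact (continuous_edist.measurable).pow_const p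

theorem exists_coupling_of_transportCost_lt {μ ν : Measure X} {c : ℝ≥0∞}
    (h : transportCost p μ ν < c) :
    ∃ γ : @Measure (X × X) (borel (X × X)), IsCoupling μ ν γ ∧
      @lintegral (X × X) (borel (X × X)) γ (fun z => edist z.1 z.2 ^ p) < c := by
  simpa only [transportCost, iInf_lt_iff, exists_prop] using h

theorem lt_of_transportCost_lt (hp : 1 ≤ p) {μ ν : Measure X} {c : ℝ}
    (h : transportCost p μ ν < ENNReal.ofReal c ^ p) : wassersteinDist p μ ν < c := by
  have hp0 : 0 < p := by linarith
  have h1 : transportCost p μ ν ^ (1 / p) < ENNReal.ofReal c := by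
    rw [one_div]
    exact (ENNReal.rpow_inv_lt_iff hp0).2 h
  have hc : 0 < c := ENNReal.ofReal_pos.1 (lt_of_le_of_lt zero_le h1)
  rw [wassersteinDist_eq]
  exact (ENNReal.toReal_lt_of_lt_ofReal h1)

/-- Finiteness is essential: `toReal` sends `∞` to `0`, so a small `wassersteinDist` alone would not
bound the cost. -/
theorem transportCost_lt_of_lt (hp : 1 ≤ p) {μ ν : Measure X} {c : ℝ}
    (hfin : transportCost p μ ν ≠ ∞) (h : wassersteinDist p μ ν < c) :
    transportCost p μ ν < ENNReal.ofReal c ^ p := by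
  have hp0 : 0 < p := by linarith
  rw [wassersteinDist_eq] at h
  rw [← ENNReal.rpow_inv_lt_iff hp0, ← one_div]
  rw [← ENNReal.ofReal_toReal (ENNReal.rpow_ne_top_of_nonneg (by positivity) hfin)]
  exact (ENNReal.ofReal_lt_ofReal_iff (lt_of_le_of_lt ENNReal.toReal_nonneg h)).2 h

theorem wassersteinDist_nonneg (μ ν : Measure X) : 0 ≤ wassersteinDist p μ ν :=
  ENNReal.toReal_nonneg

theorem exists_split_of_transportCost_lt {μ : Measure X} {M : ℕ} {y : Fin M → X} {c : ℝ≥0∞}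
    (h : transportCost p μ (cloudMeasure y) < c) :
    ∃ m : Fin M → Measure X, ∑ j, m j = μ ∧ (∀ j, m j Set.univ = (M : ℝ≥0∞)⁻¹) ∧
      ∑ j, ∫⁻ z, edist z (y j) ^ p ∂(m j) < c := by
  obtain ⟨γ, ⟨h1, h2⟩, hγ⟩ := exists_coupling_of_transportCost_lt h
  let _ : MeasurableSpace (X × X) := borel (X × X)
  have : BorelSpace (X × X) := ⟨rfl⟩
  obtain ⟨m, hm, hm1, hm2⟩ := exists_split_of_coupling (p := p) γ
    (continuous_fst (X := X) (Y := X)).measurable continuous_snd.measurable y h2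
  exact ⟨m, hm.trans h1, hm1, hm2.trans_lt hγ⟩

theorem lintegral_edist_lt_top (hp : 1 ≤ p) (μ : WassersteinSpace X p) (x : X) :
    ∫⁻ z, edist z x ^ p ∂μ.toMeasure < ∞ := by
  have := μ.isProbabilityMeasure
  obtain ⟨x₀, h⟩ := μ.finite_moment
  have hc : (2 : ℝ≥0∞) ^ (p - 1) ≠ ∞ := ENNReal.rpow_ne_top_of_nonneg (by linarith) (by simp)
  have hx : edist x₀ x ^ p ≠ ∞ := ENNReal.rpow_ne_top_of_nonneg (by linarith) (edist_ne_top _ _)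
  calc ∫⁻ z, edist z x ^ p ∂μ.toMeasure
      ≤ ∫⁻ z, 2 ^ (p - 1) * (edist z x₀ ^ p + edist x₀ x ^ p) ∂μ.toMeasure := by
        refine lintegral_mono fun z => ?_
        exact (ENNReal.rpow_le_rpow (edist_triangle z x₀ x) (by linarith)).trans
          (ENNReal.rpow_add_le_mul_rpow_add_rpow _ _ hp)
    _ < ∞ := by
        rw [lintegral_const_mul' _ _ hc, lintegral_add_right _ measurable_const, lintegral_const,
          measure_univ, mul_one]
        exact ENNReal.mul_lt_top hc.lt_top (ENNReal.add_lt_top.2 ⟨h, hx.lt_top⟩)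

/-- The product coupling costs an average of finitely many `p`-th moments of `μ`. This rules out the
default value of `toReal` wherever one of the measures is a cloud. -/
theorem transportCost_cloud_ne_top (hp : 1 ≤ p) (μ : WassersteinSpace X p) {N : ℕ} [NeZero N]
    (x : Fin N → X) : transportCost p μ.toMeasure (cloudMeasure x) ≠ ∞ := by
  have := μ.isProbabilityMeasure
  set κ : Measure (Fin N) := (N : ℝ≥0∞)⁻¹ • Measure.count with hκ
  have hN : (N : ℝ≥0∞) ≠ 0 := by simpa using NeZero.ne N
  have hκ1 : IsProbabilityMeasure κ := ⟨by
    simp [hκ, ENNReal.inv_mul_cancel hN]⟩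
  have h1 : (μ.toMeasure.prod κ).map Prod.fst = μ.toMeasure := by
    rw [Measure.map_fst_prod, measure_univ, one_smul]
  have h2 : (μ.toMeasure.prod κ).map (fun q => x q.2) = cloudMeasure x := by
    have : (fun q : X × Fin N => x q.2) = x ∘ Prod.snd := rfl
    rw [this, ← Measure.map_map (measurable_of_countable _) measurable_snd, Measure.map_snd_prod,
      measure_univ, one_smul]
    ext s hs
    rw [Measure.map_apply (measurable_of_countable _) hs]
    simp [hκ, cloudMeasure, Measure.count, Measure.dirac_apply' _ hs]
    rfl
  have hle := transportCost_le (p := p) (μ.toMeasure.prod κ) (f := Prod.fst)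
    (g := fun q => x q.2) (by
      let _ : MeasurableSpace (X × X) := borel (X × X)
      have : BorelSpace (X × X) := ⟨rfl⟩
      refine measurable_from_prod_countable_left fun j => ?_
      exact Continuous.measurable (show Continuous fun z : X => (z, x j) by fun_prop))
  rw [h1, h2] at hle
  refine ne_top_of_le_ne_top ?_ hle
  rw [lintegral_prod_symm _ (measurable_from_prod_countable_left fun j =>
    (measurable_edist_left (x := x j)).pow_const p).aemeasurable, hκ, lintegral_smul_measure,
    lintegral_count, tsum_fintype]
  refine ENNReal.mul_ne_top (by simpa using hN) (ENNReal.sum_ne_top.2 fun j _ => ?_)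
  exact (lintegral_edist_lt_top hp μ (x j)).ne

/-- Triangle inequality through a measure for clouds, in terms of transport matrices. -/
theorem exists_matrix (hp : 1 ≤ p) (μ : WassersteinSpace X p) {N M : ℕ} [NeZero N] [NeZero M]
    {x : Fin N → X} {y : Fin M → X} {a b : ℝ}
    (hx : wassersteinDist p μ.toMeasure (cloudMeasure x) < a)
    (hy : wassersteinDist p μ.toMeasure (cloudMeasure y) < b) :
    ∃ r : Fin N → Fin M → ℝ≥0∞, (∀ j, ∑ k, r j k = (N : ℝ≥0∞)⁻¹) ∧
      (∀ k, ∑ j, r j k = (M : ℝ≥0∞)⁻¹) ∧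
      ∑ j, ∑ k, r j k * edist (x j) (y k) ^ p < ENNReal.ofReal (a + b) ^ p := by
  have hp0 : 0 < p := by linarith
  have := μ.isProbabilityMeasure
  have ha := (wassersteinDist_nonneg _ _).trans_lt hx
  have hb := (wassersteinDist_nonneg _ _).trans_lt hy
  obtain ⟨m, hm, hm1, hm2⟩ := exists_split_of_transportCost_lt
    (transportCost_lt_of_lt hp (transportCost_cloud_ne_top hp μ x) hx)
  obtain ⟨n, hn, hn1, hn2⟩ := exists_split_of_transportCost_lt
    (transportCost_lt_of_lt hp (transportCost_cloud_ne_top hp μ y) hy)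
  obtain ⟨r, hr1, hr2, hr⟩ := exists_matrix_of_split hp μ.toMeasure x y m n hm hn hm1 hn1
  refine ⟨r, hr1, hr2, ?_⟩
  rw [← ENNReal.rpow_inv_lt_iff hp0] at hm2 hn2 ⊢
  rw [one_div] at hr
  rw [ENNReal.ofReal_add ha.le hb.le]
  exact hr.trans_lt (ENNReal.add_lt_add hm2 hn2)

/-- A transport matrix bounds the Wasserstein distance of clouds. -/
theorem wassersteinDist_lt_of_matrix (hp : 1 ≤ p) {N M : ℕ} {x : Fin N → X} {y : Fin M → X}
    {c : ℝ} (r : Fin N → Fin M → ℝ≥0∞) (hr1 : ∀ j, ∑ k, r j k = (N : ℝ≥0∞)⁻¹)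
    (hr2 : ∀ k, ∑ j, r j k = (M : ℝ≥0∞)⁻¹)
    (hr : ∑ j, ∑ k, r j k * edist (x j) (y k) ^ p < ENNReal.ofReal c ^ p) :
    wassersteinDist p (cloudMeasure x) (cloudMeasure y) < c := by
  refine lt_of_transportCost_lt hp (lt_of_le_of_lt ?_ hr)
  set γ : Measure (Fin N × Fin M) := ∑ q, r q.1 q.2 • Measure.dirac q with hγ
  have hx : γ.map (fun q => x q.1) = cloudMeasure x := by
    ext s hs
    rw [Measure.map_apply (measurable_of_countable _) hs]
    simp only [hγ, cloudMeasure, Measure.coe_finsetSum, Finset.sum_apply, Measure.smul_apply,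
      smul_eq_mul, Fintype.sum_prod_type, Finset.mul_sum, Measure.dirac_apply' _ hs]
    refine Finset.sum_congr rfl fun j _ => ?_
    rw [← hr1 j, Finset.sum_mul]
    refine Finset.sum_congr rfl fun k _ => ?_
    rw [Measure.dirac_apply]
    rfl
  have hy : γ.map (fun q => y q.2) = cloudMeasure y := by
    ext s hs
    rw [Measure.map_apply (measurable_of_countable _) hs]
    simp only [hγ, cloudMeasure, Measure.coe_finsetSum, Finset.sum_apply, Measure.smul_apply,
      smul_eq_mul, Fintype.sum_prod_type_right, Finset.mul_sum, Measure.dirac_apply' _ hs]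
    refine Finset.sum_congr rfl fun k _ => ?_
    rw [← hr2 k, Finset.sum_mul]
    refine Finset.sum_congr rfl fun j _ => ?_
    rw [Measure.dirac_apply]
    rfl
  rw [← hx, ← hy]
  refine (transportCost_le γ (by
    let _ : MeasurableSpace (X × X) := borel (X × X)
    exact measurable_of_countable _)).trans ?_
  simp [hγ, lintegral_finsetSum_measure, lintegral_smul_measure, Fintype.sum_prod_type]

/-- Markov's inequality for transport plans. -/
theorem measure_le_thickening (hp : 1 ≤ p) {μ ν : Measure X} {c η : ℝ} (hη : 0 < η)
    (h : transportCost p μ ν < ENNReal.ofReal c ^ p) {A : Set X} (hA : MeasurableSet A) :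
    μ A ≤ ν (Metric.thickening η A) + ENNReal.ofReal (c / η) ^ p := by
  have hp0 : 0 < p := by linarith
  obtain ⟨γ, ⟨h1, h2⟩, hγ⟩ := exists_coupling_of_transportCost_lt h
  let _ : MeasurableSpace (X × X) := borel (X × X)
  have : BorelSpace (X × X) := ⟨rfl⟩
  have m1 : Measurable (Prod.fst : X × X → X) := continuous_fst.measurable
  have m2 : Measurable (Prod.snd : X × X → X) := continuous_snd.measurable
  have hmd : Measurable fun z : X × X => edist z.1 z.2 ^ p :=
    (continuous_edist.measurable).pow_const p
  have hη' : ENNReal.ofReal η ^ p ≠ 0 := by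
    simp [hη]
  have hη'' : ENNReal.ofReal η ^ p ≠ ∞ := ENNReal.rpow_ne_top_of_nonneg hp0.le ENNReal.ofReal_ne_top
  rw [← h1, ← h2, Measure.map_apply m1 hA, Measure.map_apply m2 Metric.isOpen_thickening.measurableSet]
  -- Mass starting in `A` either ends in the thickening or travels at least `η`.
  have hsub : Prod.fst ⁻¹' A ⊆ (Prod.snd ⁻¹' Metric.thickening η A) ∪
      {z : X × X | ENNReal.ofReal η ^ p ≤ edist z.1 z.2 ^ p} := by
    intro z hz
    by_cases hd : dist z.2 z.1 < η
    · exact Or.inl (Metric.mem_thickening_iff.2 ⟨z.1, hz, hd⟩)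
    · refine Or.inr (ENNReal.rpow_le_rpow ?_ hp0.le)
      rw [edist_dist, dist_comm]
      exact ENNReal.ofReal_le_ofReal (not_lt.1 hd)
  refine (measure_mono hsub).trans ((measure_union_le _ _).trans ?_)
  gcongr
  refine (meas_ge_le_lintegral_div hmd.aemeasurable hη' hη'').trans ?_
  rw [ENNReal.ofReal_div_of_pos hη, ENNReal.div_rpow_of_nonneg _ _ hp0.le]
  gcongr

end Transport


/-! ### Density of clouds -/

section Density

open Topology

variable {X : Type*} [MetricSpace X] [MeasurableSpace X] [BorelSpace X] {p : ℝ}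

/-- One enumeration serves every `f`, so a cloud with prescribed multiplicities can be tested
against all indicator functions. -/
theorem exists_fin_enumeration {Y : Type*} (s : Multiset Y) :
    ∃ x : Fin (Multiset.card s) → Y, ∀ {A : Type} [AddCommMonoid A] (f : Y → A),
      ∑ j, f (x j) = (s.map f).sum := by
  induction s using Quotient.inductionOn with
  | h l =>
    refine ⟨l.get, fun f => ?_⟩
    change ∑ j : Fin l.length, f (l.get j) = _
    rw [Multiset.quot_mk_to_coe, Multiset.map_coe, Multiset.sum_coe, ← List.sum_ofFn]
    congr 1
    exact List.ext_get (by simp) (by simp)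

/-- A measure is within small transport cost of its image under a suitable simple function. -/
theorem exists_simpleFunc_lintegral_lt (hp : 1 ≤ p) (μ : WassersteinSpace X p) {ε : ℝ≥0∞}
    (hε : 0 < ε) :
    ∃ S : SimpleFunc X X, ∫⁻ z, edist z (S z) ^ p ∂μ.toMeasure < ε := by
  have hp0 : 0 < p := by linarith
  have := μ.isProbabilityMeasure
  have := μ.innerRegular
  obtain ⟨x₀, -⟩ := μ.finite_moment
  -- Inner regularity concentrates `μ` on a σ-compact, hence separable, set; `X` itself need not be
  -- separable.
  have hK : ∀ n : ℕ, ∃ K : Set X, IsCompact K ∧ μ.toMeasure Kᶜ < ((n : ℝ≥0∞) + 1)⁻¹ := fun n => by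
    obtain ⟨K, -, hK, h⟩ := MeasurableSet.univ.exists_isCompact_sdiff_lt (μ := μ.toMeasure)
      (measure_ne_top _ _) (ε := ((n : ℝ≥0∞) + 1)⁻¹) (by simp)
    exact ⟨K, hK, by rwa [Set.compl_eq_univ_sdiff]⟩
  choose K hKc hK using hK
  have hnull : μ.toMeasure (⋃ n, K n)ᶜ = 0 := by
    refine le_antisymm (ge_of_tendsto' (x := atTop)
      (ENNReal.tendsto_inv_nat_nhds_zero.comp (tendsto_add_atTop_nat 1)) fun n => ?_) zero_le
    refine (measure_mono (Set.compl_subset_compl.2 (Set.subset_iUnion K n))).trans ?_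
    simpa using (hK n).le
  obtain ⟨c, hc, hcK⟩ : TopologicalSpace.IsSeparable (⋃ n, K n) :=
    TopologicalSpace.isSeparable_iUnion.2 fun n => (hKc n).isSeparable
  obtain ⟨f, hf⟩ := (hc.insert x₀).exists_eq_range (Set.insert_nonempty _ _)
  -- The sequence starts at `x₀`, so the nearest point is never farther than `x₀` and `edist z x₀ ^
  -- p` dominates.
  set d : ℕ → X := fun n => Nat.casesOn n x₀ f with hd
  have hdr : ∀ᵐ z ∂μ.toMeasure, z ∈ closure (Set.range d) := by
    refine measure_mono_null ?_ hnull
    refine Set.compl_subset_compl.2 (hcK.trans (closure_mono ?_))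
    intro z hz
    obtain ⟨n, hn⟩ : z ∈ Set.range f := hf ▸ Set.mem_insert_of_mem _ hz
    exact ⟨n + 1, hn⟩
  have hmeas : ∀ n, Measurable fun z => edist z (SimpleFunc.nearestPt d n z) ^ p := fun n =>
    Measurable.pow_const ((SimpleFunc.nearestPt d n).measurable_bind (fun v z => edist z v)
      fun v => measurable_edist_left) p
  have hlim := tendsto_lintegral_of_dominated_convergence (μ := μ.toMeasure)
    (F := fun n z => edist z (SimpleFunc.nearestPt d n z) ^ p) (f := fun _ => 0)
    (fun z => edist z x₀ ^ p) hmeas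
    (fun n => Eventually.of_forall fun z => by
      refine ENNReal.rpow_le_rpow ?_ hp0.le
      rw [edist_comm, edist_comm z]
      exact SimpleFunc.edist_nearestPt_le d z (Nat.zero_le n))
    (lintegral_edist_lt_top hp μ x₀).ne
    (by
      filter_upwards [hdr] with z hz
      have h1 : Tendsto (fun n => edist z (SimpleFunc.nearestPt d n z)) atTop (𝓝 0) := by
        have := (tendsto_const_nhds (x := z)).edist (SimpleFunc.tendsto_nearestPt hz)
        rwa [edist_self] at this
      have h2 := (ENNReal.continuous_rpow_const (y := p)).tendsto 0 |>.comp h1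
      rwa [ENNReal.zero_rpow_of_pos hp0] at h2)
  rw [lintegral_zero] at hlim
  obtain ⟨n, hn⟩ := (hlim.eventually (gt_mem_nhds hε)).exists
  exact ⟨_, hn⟩

theorem lintegral_comp_simpleFunc (μ : Measure X) (S : SimpleFunc X X) (h : X → ℝ≥0∞) :
    ∫⁻ z, h (S z) ∂μ = ∑ v ∈ S.range, h v * μ (S ⁻¹' {v}) := by
  rw [← SimpleFunc.map_lintegral, ← SimpleFunc.lintegral_eq_lintegral]
  rfl

/-- Rounding the weights of a simple function: the rest of the mass is moved to `x₀`. -/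
theorem exists_cloud_transportCost_le (μ : Measure X) [IsProbabilityMeasure μ]
    (S : SimpleFunc X X) (x₀ : X) (n : ℕ) [NeZero n] :
    ∃ x : Fin n → X, transportCost p μ (cloudMeasure x) ≤
      ∫⁻ z, edist z (S z) ^ p ∂μ +
        (n : ℝ≥0∞)⁻¹ * ∫⁻ z, (μ (S ⁻¹' {S z}))⁻¹ * edist z x₀ ^ p ∂μ := by
  have hn0 : (n : ℝ≥0∞) ≠ 0 := by simpa using NeZero.ne n
  have hnt : (n : ℝ≥0∞) ≠ ∞ := ENNReal.natCast_ne_top _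
  set W : X → ℝ≥0∞ := fun v => μ (S ⁻¹' {v}) with hW
  have hWt : ∀ v, W v ≠ ∞ := fun v => measure_ne_top _ _
  -- The weights are rounded down to multiples of `1/n`; the leftover points of the cloud are placed
  -- at `x₀`.
  set c : X → ℕ := fun v => ⌊(n * W v).toReal⌋₊ with hc
  have hcW : ∀ v, (c v : ℝ≥0∞) ≤ n * W v := fun v => by
    rw [← ENNReal.toReal_le_toReal (by simp) (ENNReal.mul_ne_top hnt (hWt v)),
      ENNReal.toReal_natCast]
    exact Nat.floor_le ENNReal.toReal_nonneg
  have hcW' : ∀ v, n * W v ≤ (c v : ℝ≥0∞) + 1 := fun v => by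
    rw [← ENNReal.toReal_le_toReal (ENNReal.mul_ne_top hnt (hWt v)) (by simp),
      ENNReal.toReal_add (by simp) (by simp), ENNReal.toReal_natCast, ENNReal.toReal_one]
    exact (Nat.lt_floor_add_one _).le
  have hWsum : ∑ v ∈ S.range, W v = 1 := by
    have := lintegral_comp_simpleFunc μ S fun _ => 1
    simpa using this.symm
  have hcn : ∑ v ∈ S.range, c v ≤ n := by
    have : ((∑ v ∈ S.range, c v : ℕ) : ℝ≥0∞) ≤ n := by
      push_cast
      refine (Finset.sum_le_sum fun v _ => hcW v).trans ?_
      rw [← Finset.mul_sum, hWsum, mul_one]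
    exact_mod_cast this
  -- The share of the fibre over `v` that is sent to `v`. On a null fibre `c v = 0`, and `0 * ∞ = 0`
  -- is harmless.
  set U : X → ℝ≥0∞ := fun v => (c v : ℝ≥0∞) * (n : ℝ≥0∞)⁻¹ * (W v)⁻¹ with hU
  have hUW : ∀ v, U v * W v = c v * (n : ℝ≥0∞)⁻¹ := fun v => by
    by_cases h0 : W v = 0
    · have : (c v : ℝ≥0∞) = 0 := by simpa [h0] using hcW v
      simp [h0, this]
    · rw [hU, mul_assoc, ENNReal.inv_mul_cancel h0 (hWt v), mul_one]
  have hU1 : ∀ v, U v ≤ 1 := fun v => by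
    by_cases h0 : W v = 0
    · have : (c v : ℝ≥0∞) = 0 := by simpa [h0] using hcW v
      simp [hU, this]
    · calc U v ≤ (n * W v) * (n : ℝ≥0∞)⁻¹ * (W v)⁻¹ := by
            simp only [hU]; gcongr; exact hcW v
        _ = (n * (n : ℝ≥0∞)⁻¹) * (W v * (W v)⁻¹) := by ring
        _ = 1 := by rw [ENNReal.mul_inv_cancel hn0 hnt, ENNReal.mul_inv_cancel h0 (hWt v), one_mul]
  -- Rounding moves at most mass `1/n` out of each fibre.
  have hU2 : ∀ v, 1 - U v ≤ (n : ℝ≥0∞)⁻¹ * (W v)⁻¹ := fun v => by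
    rw [tsub_le_iff_right]
    by_cases h0 : W v = 0
    · simp [h0, ENNReal.mul_top, hnt]
    · calc (1 : ℝ≥0∞) = (n * (n : ℝ≥0∞)⁻¹) * (W v * (W v)⁻¹) := by
            rw [ENNReal.mul_inv_cancel hn0 hnt, ENNReal.mul_inv_cancel h0 (hWt v), one_mul]
        _ = (n * W v) * ((n : ℝ≥0∞)⁻¹ * (W v)⁻¹) := by ring
        _ ≤ (c v + 1) * ((n : ℝ≥0∞)⁻¹ * (W v)⁻¹) := by gcongr; exact hcW' v
        _ = _ := by simp only [hU]; ring
  have hUS : Measurable fun z => U (S z) := (S.map U).measurable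
  have hUS' : Measurable fun z => 1 - U (S z) := (S.map fun v => 1 - U v).measurable
  -- the cloud
  obtain ⟨x, hx⟩ : ∃ x : Fin n → X, ∀ {A : Type} [AddCommMonoid A] (f : X → A),
      ∑ j, f (x j) = ∑ v ∈ S.range, c v • f v + (n - ∑ v ∈ S.range, c v) • f x₀ := by
    obtain ⟨x, hx⟩ := exists_fin_enumeration
      (∑ v ∈ S.range, Multiset.replicate (c v) v + Multiset.replicate (n - ∑ v ∈ S.range, c v) x₀)
    have hcard : Multiset.card (∑ v ∈ S.range, Multiset.replicate (c v) v +
        Multiset.replicate (n - ∑ v ∈ S.range, c v) x₀) = n := by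
      simp only [Multiset.card_add, Multiset.card_sum, Multiset.card_replicate]
      omega
    refine ⟨fun j => x (Fin.cast hcard.symm j), fun f => ?_⟩
    rw [← Equiv.sum_comp (finCongr hcard)]
    refine (hx f).trans ?_
    rw [Multiset.map_add, Multiset.sum_add, Multiset.map_replicate, Multiset.sum_replicate]
    congr 1
    have : ∀ s : Finset X, ((∑ v ∈ s, Multiset.replicate (c v) v).map f).sum =
        ∑ v ∈ s, c v • f v := by
      classical
      intro s
      induction s using Finset.induction_on with
      | empty => simp
      | insert a s ha ih => simp [Finset.sum_insert ha, ih]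
    exact this _
  refine ⟨x, ?_⟩
  -- the coupling
  set τ : Measure (X × Bool) :=
    (μ.prod Measure.count).withDensity fun q => bif q.2 then U (S q.1) else 1 - U (S q.1) with hτ
  have hdm : Measurable fun q : X × Bool => bif q.2 then U (S q.1) else 1 - U (S q.1) :=
    measurable_from_prod_countable_left fun b => by cases b <;> assumption
  have hint : ∀ h : X × Bool → ℝ≥0∞, Measurable h → ∫⁻ q, h q ∂τ =
      ∫⁻ z, U (S z) * h (z, true) ∂μ + ∫⁻ z, (1 - U (S z)) * h (z, false) ∂μ := by
    intro h hh
    rw [hτ, lintegral_withDensity_eq_lintegral_mul _ hdm hh,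
      lintegral_prod_symm _ (hdm.mul hh).aemeasurable, lintegral_count, tsum_fintype]
    simp
  set g : X × Bool → X := fun q => bif q.2 then S q.1 else x₀ with hg
  have hgm : Measurable g := measurable_from_prod_countable_left fun b => by
    cases b
    · exact measurable_const (a := x₀)
    · exact S.measurable
  -- The Borel σ-algebra of `X × X` may exceed the product σ-algebra; the pair is still measurable
  -- because `g` takes finitely many values.
  have hpair : @Measurable _ _ _ (borel (X × X)) fun q : X × Bool => (q.1, g q) := by
    let _ : MeasurableSpace (X × X) := borel (X × X)
    have : BorelSpace (X × X) := ⟨rfl⟩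
    have hv : ∀ v : X, Measurable fun z : X => (z, v) := fun v =>
      Continuous.measurable (by fun_prop)
    refine measurable_from_prod_countable_left fun b => ?_
    cases b
    · exact hv x₀
    · exact S.measurable_bind (fun v z => (z, v)) hv
  have h1 : τ.map Prod.fst = μ := by
    ext s hs
    rw [← lintegral_indicator_one hs, ← lintegral_indicator_one hs,
      lintegral_map (measurable_one.indicator hs) measurable_fst,
      hint (fun q => s.indicator 1 q.1) ((measurable_one.indicator hs).comp measurable_fst)]
    have hUs : Measurable fun z => U (S z) * s.indicator 1 z :=
      hUS.mul (measurable_one.indicator hs)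
    dsimp only
    rw [← lintegral_add_left hUs]
    refine lintegral_congr fun z => ?_
    rw [← add_mul, add_tsub_cancel_of_le (hU1 _), one_mul]
  have hlint : ∀ k : X → ℝ≥0∞, ∫⁻ z, U (S z) * k (S z) ∂μ =
      ∑ v ∈ S.range, c v * (n : ℝ≥0∞)⁻¹ * k v := fun k => by
    rw [lintegral_comp_simpleFunc μ S fun v => U v * k v]
    refine Finset.sum_congr rfl fun v _ => ?_
    rw [← hUW v, mul_right_comm]
  have hrest : ∫⁻ z, 1 - U (S z) ∂μ = ((n - ∑ v ∈ S.range, c v : ℕ) : ℝ≥0∞) * (n : ℝ≥0∞)⁻¹ := by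
    have hUi : ∫⁻ z, U (S z) ∂μ = (∑ v ∈ S.range, c v : ℕ) * (n : ℝ≥0∞)⁻¹ := by
      have := hlint fun _ => 1
      simpa [Finset.sum_mul] using this
    have hne : ∫⁻ z, U (S z) ∂μ ≠ ∞ := by
      rw [hUi]; exact ENNReal.mul_ne_top (by simp) (by simpa using hn0)
    rw [lintegral_sub hUS hne (Eventually.of_forall fun z => hU1 _), hUi, lintegral_const,
      measure_univ, mul_one, ENNReal.natCast_sub, ENNReal.sub_mul (fun _ _ => by simpa using hn0),
      ENNReal.mul_inv_cancel hn0 hnt]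
  have h2 : τ.map g = cloudMeasure x := by
    ext s hs
    have hxs := hx fun v => s.indicator (1 : X → ℝ≥0∞) v
    rw [← lintegral_indicator_one hs, lintegral_map (measurable_one.indicator hs) hgm,
      hint (fun q => s.indicator 1 (g q)) ((measurable_one.indicator hs).comp hgm)]
    simp only [hg, cond_true, cond_false]
    rw [hlint (s.indicator 1), lintegral_mul_const _ hUS', hrest]
    simp only [cloudMeasure, Measure.smul_apply, Measure.coe_finsetSum, Finset.sum_apply,
      Measure.dirac_apply' _ hs, hxs, smul_eq_mul, nsmul_eq_mul, mul_add, Finset.mul_sum]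
    congr 1
    · exact Finset.sum_congr rfl fun v _ => by ring
    · ring
  have hle := transportCost_le (p := p) τ hpair
  rw [h1, h2] at hle
  refine hle.trans ?_
  have hem : Measurable fun q : X × Bool => edist q.1 (g q) ^ p := by
    refine Measurable.pow_const (measurable_from_prod_countable_left fun b => ?_) p
    cases b
    · exact measurable_edist_left (x := x₀)
    · exact S.measurable_bind (fun v z => edist z v) fun v => measurable_edist_left
  rw [hint _ hem]
  refine add_le_add (lintegral_mono fun z => ?_) ?_
  · exact (mul_le_mul_left (hU1 _) _).trans_eq (one_mul _)
  · rw [← lintegral_const_mul' _ _ (by simpa using hn0)]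
    refine lintegral_mono fun z => ?_
    rw [← mul_assoc]
    exact mul_le_mul_left (hU2 _) _

/-- Clouds are dense in the Wasserstein space. -/
theorem exists_cloud_wassersteinDist_lt (hp : 1 ≤ p) (μ : WassersteinSpace X p) {δ : ℝ}
    (hδ : 0 < δ) : ∃ (n : ℕ) (_ : NeZero n) (x : Fin n → X),
      wassersteinDist p μ.toMeasure (cloudMeasure x) < δ := by
  have hp0 : 0 < p := by linarith
  have := μ.isProbabilityMeasure
  obtain ⟨x₀, -⟩ := μ.finite_moment
  set ε : ℝ≥0∞ := ENNReal.ofReal δ ^ p with hε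
  have hε0 : ε ≠ 0 := by simp [hε, hδ]
  obtain ⟨S, hS⟩ := exists_simpleFunc_lintegral_lt hp μ (ENNReal.half_pos hε0)
  classical
  -- Null fibres, whose inverse weight is `∞`, are left out; almost every `z` avoids them. Hence the
  -- rounding error is `1/n` times a finite constant `D`.
  set C : ℝ≥0∞ := ∑ v ∈ S.range with μ.toMeasure (S ⁻¹' {v}) ≠ 0, (μ.toMeasure (S ⁻¹' {v}))⁻¹
    with hC
  have hCt : C ≠ ∞ := ENNReal.sum_ne_top.2 fun v hv => by
    simpa using (Finset.mem_filter.1 hv).2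
  have hae : ∀ᵐ z ∂μ.toMeasure, (μ.toMeasure (S ⁻¹' {S z}))⁻¹ ≤ C := by
    have h0 : ∀ᵐ z ∂μ.toMeasure, μ.toMeasure (S ⁻¹' {S z}) ≠ 0 := by
      have : ∀ v ∈ S.range, ∀ᵐ z ∂μ.toMeasure, S z = v → μ.toMeasure (S ⁻¹' {v}) ≠ 0 := by
        intro v _
        by_cases h : μ.toMeasure (S ⁻¹' {v}) = 0
        · filter_upwards [measure_eq_zero_iff_ae_notMem.1 h] with z hz h'
          exact absurd h' hz
        · exact Eventually.of_forall fun z _ => h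
      filter_upwards [(ae_ball_iff S.range.countable_toSet).2 this] with z hz
      exact hz _ (S.mem_range_self z) rfl
    filter_upwards [h0] with z hz
    exact Finset.single_le_sum (f := fun v => (μ.toMeasure (S ⁻¹' {v}))⁻¹) (fun _ _ => zero_le)
      (Finset.mem_filter.2 ⟨S.mem_range_self z, hz⟩)
  set D := ∫⁻ z, (μ.toMeasure (S ⁻¹' {S z}))⁻¹ * edist z x₀ ^ p ∂μ.toMeasure with hD
  have hDt : D ≠ ∞ := by
    refine ne_top_of_le_ne_top (ENNReal.mul_ne_top hCt (lintegral_edist_lt_top hp μ x₀).ne) ?_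
    rw [← lintegral_const_mul' _ _ hCt]
    refine lintegral_mono_ae ?_
    filter_upwards [hae] with z hz
    gcongr
  have hlim : Tendsto (fun n : ℕ => ((n + 1 : ℕ) : ℝ≥0∞)⁻¹ * D) atTop (𝓝 0) := by
    have := ENNReal.Tendsto.mul_const
      (ENNReal.tendsto_inv_nat_nhds_zero.comp (tendsto_add_atTop_nat 1)) (Or.inr hDt)
    rwa [zero_mul] at this
  obtain ⟨n, hn⟩ := (hlim.eventually (gt_mem_nhds (ENNReal.half_pos hε0))).exists
  obtain ⟨x, hx⟩ := exists_cloud_transportCost_le (p := p) μ.toMeasure S x₀ (n + 1)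
  refine ⟨n + 1, inferInstance, x, lt_of_transportCost_lt hp (hx.trans_lt ?_)⟩
  exact (ENNReal.add_lt_add hS hn).trans_eq (ENNReal.add_halves _)

end Density


/-! ### Limits along an ultrafilter -/

section Limits

open Topology

variable {ω : Ultrafilter ℕ}

theorem st_eq_of_tendsto {f : ℕ → ℝ} {L : ℝ} (h : Tendsto f ω (𝓝 L)) :
    st ((f : ℕ → ℝ) : HyperReal ω) = L := by
  refine ArchimedeanClass.stdPart_eq (realHom ω) (fun s hs => ?_) fun s hs => ?_
  · exact Germ.coe_le.2 ((h.eventually (lt_mem_nhds hs)).mono fun i hi => hi.le)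
  · exact Germ.coe_le.2 ((h.eventually (gt_mem_nhds hs)).mono fun i hi => hi.le)

theorem exists_tendsto_of_eventually_mem_Icc {f : ℕ → ℝ} {a b : ℝ}
    (h : ∀ᶠ i in (ω : Filter ℕ), f i ∈ Set.Icc a b) : ∃ L ∈ Set.Icc a b, Tendsto f ω (𝓝 L) :=
  isCompact_Icc.ultrafilter_le_nhds (ω.map f) (le_principal_iff.2 h)

/-- Diagonalization along a non-principal ultrafilter. -/
theorem exists_diagonal (hω : ∀ n : ℕ, ω ≠ pure n) {P : ℕ → ℕ → Prop}
    (hP : ∀ m, ∀ᶠ i in (ω : Filter ℕ), P m i) :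
    ∃ k : ℕ → ℕ, (∀ i, ∀ m < k i, P m i) ∧ ∀ n, ∀ᶠ i in (ω : Filter ℕ), n ≤ k i := by
  classical
  have hle : (ω : Filter ℕ) ≤ atTop := by
    rw [← Nat.cofinite_eq_atTop]
    exact ω.le_cofinite_or_eq_pure.resolve_right fun ⟨n, hn⟩ => hω n hn
  -- Searching only up to `i` makes the maximum exist. As `ω` refines `atTop`, this cap still
  -- exceeds every `n` almost everywhere.
  refine ⟨fun i => Nat.findGreatest (fun k => ∀ m < k, P m i) i, fun i => ?_, fun n => ?_⟩
  · exact Nat.findGreatest_spec (P := fun k => ∀ m < k, P m i) (Nat.zero_le i) (by simp)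
  · have h1 : ∀ᶠ i in (ω : Filter ℕ), ∀ m < n, P m i :=
      (Set.finite_Iio n).eventually_all.2 fun m _ => hP m
    filter_upwards [h1, hle (eventually_ge_atTop n)] with i hi hn
    exact Nat.le_findGreatest hn hi

variable {X : ℕ → Type*} [∀ i, MetricSpace (X i)] {e : ∀ i, X i}

/-- The sequence `z` represents the point `t` of the metric ultralimit. -/
def Represents (z : ∀ i, X i) (t : UltraLimit ω e) : Prop :=
  ∃ h : UltraProd.mk ω z ∈ limitedSet ω e, stHat (⟨UltraProd.mk ω z, h⟩ : Limited ω e) = t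

theorem exists_represents (t : UltraLimit ω e) : ∃ z : ∀ i, X i, Represents z t := by
  obtain ⟨⟨x, hx⟩, rfl⟩ := SeparationQuotient.surjective_mk t
  induction x using Quotient.inductionOn with
  | h z => exact ⟨z, hx, rfl⟩

theorem mk_mem_limitedSet_iff {z : ∀ i, X i} : UltraProd.mk ω z ∈ limitedSet ω e ↔
    ∃ r : ℝ, ∀ᶠ i in (ω : Filter ℕ), dist (e i) (z i) ≤ r :=
  exists_congr fun _ => Germ.coe_le

theorem represents_base (ω : Ultrafilter ℕ) (e : ∀ i, X i) :
    ∃ t : UltraLimit ω e, Represents e t :=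
  ⟨_, mk_mem_limitedSet_iff.2 ⟨0, Eventually.of_forall fun _ => (dist_self _).le⟩, rfl⟩

/-- The distances are bounded for almost all `i`, so compactness gives a limit along `ω`, and the
standard part of a germ equals that limit. -/
theorem Represents.tendsto_dist {y z : ∀ i, X i} {s t : UltraLimit ω e} (hy : Represents y s)
    (hz : Represents z t) : Tendsto (fun i => dist (y i) (z i)) ω (𝓝 (dist s t)) := by
  obtain ⟨hy, rfl⟩ := hy
  obtain ⟨hz, rfl⟩ := hz
  obtain ⟨a, ha⟩ := mk_mem_limitedSet_iff.1 hy
  obtain ⟨b, hb⟩ := mk_mem_limitedSet_iff.1 hz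
  obtain ⟨L, -, hL⟩ := exists_tendsto_of_eventually_mem_Icc (ω := ω)
    (f := fun i => dist (y i) (z i)) (a := 0) (b := a + b) (by
      filter_upwards [ha, hb] with i hi hi'
      refine ⟨dist_nonneg, (dist_triangle_left _ _ (e i)).trans (add_le_add hi hi')⟩)
  have : dist (stHat (⟨_, hy⟩ : Limited ω e)) (stHat ⟨_, hz⟩) = L := st_eq_of_tendsto hL
  rwa [this]

end Limits

/-! ### Clouds in the ultralimit and their representatives -/

section Clouds

open Topology

variable {ω : Ultrafilter ℕ} {X : ℕ → Type*} [∀ i, MetricSpace (X i)]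
  [∀ i, MeasurableSpace (X i)] [∀ i, BorelSpace (X i)] {e : ∀ i, X i} {p : ℝ}

/-- The cost of a fixed matrix depends continuously on finitely many distances, which converge along
`ω`; finite entries avoid the discontinuity of the product at `∞ * 0`. -/
theorem eventually_matrix_lt {N M : ℕ} {x : Fin N → ∀ i, X i} {y : Fin M → ∀ i, X i}
    {s : Fin N → UltraLimit ω e} {t : Fin M → UltraLimit ω e}
    (hx : ∀ j, Represents (x j) (s j)) (hy : ∀ k, Represents (y k) (t k))
    {r : Fin N → Fin M → ℝ≥0∞} (hr : ∀ j k, r j k ≠ ∞) {c : ℝ≥0∞}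
    (h : ∑ j, ∑ k, r j k * edist (s j) (t k) ^ p < c) :
    ∀ᶠ i in (ω : Filter ℕ), ∑ j, ∑ k, r j k * edist (x j i) (y k i) ^ p < c := by
  refine Tendsto.eventually (tendsto_finsetSum _ fun j _ => tendsto_finsetSum _ fun k _ => ?_)
    (gt_mem_nhds h)
  refine ENNReal.Tendsto.const_mul ?_ (Or.inr (hr j k))
  simp only [edist_dist]
  exact (ENNReal.continuous_rpow_const.tendsto _).comp
    ((ENNReal.continuous_ofReal.tendsto _).comp ((hx j).tendsto_dist (hy k)))

theorem matrix_ne_top {N M : ℕ} [NeZero N] {r : Fin N → Fin M → ℝ≥0∞}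
    (hr : ∀ j, ∑ k, r j k = (N : ℝ≥0∞)⁻¹) (j : Fin N) (k : Fin M) : r j k ≠ ∞ := by
  have : ∑ k, r j k ≠ ∞ := by
    rw [hr]
    simpa using NeZero.ne N
  exact ENNReal.sum_ne_top.1 this k (Finset.mem_univ k)

/-- If two clouds are close to `μ`, then their representatives are close to each other. -/
theorem eventually_wassersteinDist_lt (hp : 1 ≤ p) (μ : WassersteinSpace (UltraLimit ω e) p)
    {N M : ℕ} [NeZero N] [NeZero M] {x : Fin N → ∀ i, X i} {y : Fin M → ∀ i, X i}
    {s : Fin N → UltraLimit ω e} {t : Fin M → UltraLimit ω e}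
    (hx : ∀ j, Represents (x j) (s j)) (hy : ∀ k, Represents (y k) (t k)) {a b : ℝ}
    (ha : wassersteinDist p μ.toMeasure (cloudMeasure s) < a)
    (hb : wassersteinDist p μ.toMeasure (cloudMeasure t) < b) :
    ∀ᶠ i in (ω : Filter ℕ),
      wassersteinDist p (cloudMeasure fun j => x j i) (cloudMeasure fun k => y k i) < a + b := by
  -- The row and column sums do not involve the points, so the same matrix is a transport plan in
  -- every factor.
  obtain ⟨r, hr1, hr2, hr⟩ := exists_matrix hp μ ha hb
  filter_upwards [eventually_matrix_lt hx hy (matrix_ne_top hr1) hr] with i hi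
  exact wassersteinDist_lt_of_matrix hp r hr1 hr2 hi

theorem wassersteinDist_cloud_triangle {X : Type*} [MetricSpace X] [MeasurableSpace X]
    [BorelSpace X] (hp : 1 ≤ p) {N M L : ℕ} [NeZero N] [NeZero M] [NeZero L] {z : Fin L → X}
    {x : Fin N → X} {y : Fin M → X} {a b : ℝ}
    (ha : wassersteinDist p (cloudMeasure z) (cloudMeasure x) < a)
    (hb : wassersteinDist p (cloudMeasure z) (cloudMeasure y) < b) :
    wassersteinDist p (cloudMeasure x) (cloudMeasure y) < a + b := by
  obtain ⟨r, hr1, hr2, hr⟩ := exists_matrix hp (cloud p hp z) ha hb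
  exact wassersteinDist_lt_of_matrix hp r hr1 hr2 hr

/-- Clouds `s n` converging to `μ`, representatives `x n` of these, and a diagonal sequence
`i ↦ x (k i)` of clouds which is infinitely close to the limit of the clouds `x n`. -/
structure IsDiagonalApproximation (μ : WassersteinSpace (UltraLimit ω e) p) {N : ℕ → ℕ}
    (x : ∀ n, Fin (N n) → ∀ i, X i) (s : ∀ n, Fin (N n) → UltraLimit ω e) (k : ℕ → ℕ) : Prop where
  represents : ∀ n j, Represents (x n j) (s n j)
  dist_lt : ∀ n : ℕ,
    wassersteinDist p μ.toMeasure (cloudMeasure (s n)) < 1 / ((n : ℝ) + 1)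
  diagonal_lt : ∀ n : ℕ, ∀ᶠ i in (ω : Filter ℕ), wassersteinDist p
    (cloudMeasure fun j => x n j i) (cloudMeasure fun j => x (k i) j i) < 2 / ((n : ℝ) + 1)

/-- For `n ≤ m` the lifts of `s n` and `s m` are within `1/(n+1) + 1/(m+1) ≤ 2/(n+1)` in almost
every factor, so the diagonalization applies. -/
theorem exists_isDiagonalApproximation (hω : ∀ n : ℕ, ω ≠ pure n) (hp : 1 ≤ p)
    (μ : WassersteinSpace (UltraLimit ω e) p) :
    ∃ (N : ℕ → ℕ) (_ : ∀ n, NeZero (N n)) (x : ∀ n, Fin (N n) → ∀ i, X i)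
      (s : ∀ n, Fin (N n) → UltraLimit ω e) (k : ℕ → ℕ), IsDiagonalApproximation μ x s k := by
  choose N hN s hs using fun n : ℕ => exists_cloud_wassersteinDist_lt hp μ
    (δ := 1 / ((n : ℝ) + 1)) (by positivity)
  choose x hx using fun n (j : Fin (N n)) => exists_represents (s n j)
  obtain ⟨k, hk1, hk2⟩ := exists_diagonal hω (P := fun m i => ∀ n ≤ m,
    wassersteinDist p (cloudMeasure fun j => x n j i) (cloudMeasure fun j => x m j i) <
      2 / ((n : ℝ) + 1)) (by
    intro m
    refine (Set.finite_Iic m).eventually_all.2 fun n hn => ?_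
    filter_upwards [eventually_wassersteinDist_lt hp μ (hx n) (hx m) (hs n) (hs m)] with i hi
    refine hi.trans_le ?_
    have : 1 / ((m : ℝ) + 1) ≤ 1 / ((n : ℝ) + 1) := by
      have : (n : ℝ) ≤ m := Nat.cast_le.2 hn
      gcongr
    rw [show (2 : ℝ) = 1 + 1 by norm_num, add_div]
    gcongr)
  -- Good stages lie strictly below `k i`, hence the shift; `n + 1 ≤ k i` makes the truncated
  -- subtraction exact and gives `n ≤ k i - 1`.
  refine ⟨N, hN, x, s, fun i => k i - 1, hx, hs, fun n => ?_⟩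
  filter_upwards [hk2 (n + 1)] with i hi
  exact hk1 i (k i - 1) (by omega) n (by omega)

/-- Passing through `x n`, the diagonal cloud is within `3/(n+1) + δ` of the lift of any cloud that
is `δ`-close to `μ`, and `n` is free. -/
theorem IsDiagonalApproximation.isLifting (hp : 1 ≤ p) {μ : WassersteinSpace (UltraLimit ω e) p}
    {N : ℕ → ℕ} [∀ n, NeZero (N n)] {x : ∀ n, Fin (N n) → ∀ i, X i}
    {s : ∀ n, Fin (N n) → UltraLimit ω e} {k : ℕ → ℕ}
    (h : IsDiagonalApproximation μ x s k) :
    IsLifting hp e (UltraProd.mk ω fun i => cloud p hp fun j => x (k i) j i) μ := by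
  obtain ⟨hx, hs, hk⟩ := h
  have key : ∀ (n : ℕ) {M : ℕ} [NeZero M] (y : Fin M → ∀ i, X i) (t : Fin M → UltraLimit ω e)
      (δ : ℝ), (∀ j, Represents (y j) (t j)) →
      wassersteinDist p μ.toMeasure (cloudMeasure t) < δ →
      ∀ᶠ i in (ω : Filter ℕ), wassersteinDist p (cloudMeasure fun j => x (k i) j i)
        (cloudMeasure fun j => y j i) < 2 / ((n : ℝ) + 1) + (1 / ((n : ℝ) + 1) + δ) := by
    intro n M _ y t δ hy ht
    filter_upwards [hk n, eventually_wassersteinDist_lt hp μ (hx n) hy (hs n) ht] with i h1 h2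
    exact wassersteinDist_cloud_triangle hp h1 h2
  refine ⟨?_, ?_, ?_⟩
  · obtain ⟨t, ht⟩ := represents_base ω e
    refine ⟨_, Germ.coe_le.2 ((key 0 (M := 1) (fun _ => e) (fun _ => t)
      (wassersteinDist p μ.toMeasure (cloudMeasure fun _ : Fin 1 => t) + 1) (fun _ => ht)
      (lt_add_one _)).mono fun i hi => hi.le)⟩
  · intro δ hδ
    obtain ⟨n, hn⟩ := exists_nat_one_div_lt hδ
    refine ⟨_, _, ⟨N n, inferInstance, x n, fun j => (hx n j).choose, rfl, rfl⟩, ?_⟩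
    have : (fun j => stHat (⟨_, (hx n j).choose⟩ : Limited ω e)) = s n :=
      funext fun j => (hx n j).choose_spec
    change wassersteinDist p _ (cloudMeasure fun j => stHat (⟨_, (hx n j).choose⟩ : Limited ω e)) < δ
    rw [this]
    exact (hs n).trans hn
  · intro ε hε
    refine ⟨ε / 2, by positivity, ?_⟩
    rintro _ _ ⟨M, _, y, hy, rfl, rfl⟩ hδ
    -- Then `3/(n+1) < ε/2`, the other half being spent on `δ`.
    obtain ⟨n, hn⟩ := exists_nat_one_div_lt (show (0 : ℝ) < ε / 6 by positivity)
    refine Germ.coe_lt.2 ((key n y _ (ε / 2) (fun j => ⟨hy j, rfl⟩) hδ).mono fun i hi => ?_)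
    refine hi.trans_le ?_
    have : (2 : ℝ) / ((n : ℝ) + 1) = 2 * (1 / ((n : ℝ) + 1)) := by ring
    rw [this]
    linarith

end Clouds


/-! ### Basic properties of Loeb measures -/

section LoebBasic

open Topology

variable {ω : Ultrafilter ℕ} {X : ℕ → Type*}

theorem exists_mk_eq (x : UltraProd ω X) : ∃ a : ∀ i, X i, UltraProd.mk ω a = x :=
  Quotient.exists_rep x

theorem internalSet_inter (B C : ∀ i, Set (X i)) :
    internalSet ω B ∩ internalSet ω C = internalSet ω fun i => B i ∩ C i := by
  ext x
  obtain ⟨a, rfl⟩ := exists_mk_eq x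
  simp only [Set.mem_inter_iff, mk_mem_internalSet, eventually_and]

theorem internalSet_diff (B C : ∀ i, Set (X i)) :
    internalSet ω B \ internalSet ω C = internalSet ω fun i => B i \ C i := by
  ext x
  obtain ⟨a, rfl⟩ := exists_mk_eq x
  simp only [Set.mem_sdiff, mk_mem_internalSet, eventually_and, Ultrafilter.eventually_not]

theorem internalSet_univ : internalSet ω (fun i => (Set.univ : Set (X i))) = Set.univ := by
  ext x
  obtain ⟨a, rfl⟩ := exists_mk_eq x
  simp [mk_mem_internalSet]

/-- Countable saturation: a countable cover of an internal set by internal sets has a finite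
subcover, on the level of the factors. -/
theorem eventually_subset_of_internalSet_subset_iUnion (hω : ∀ n : ℕ, ω ≠ pure n)
    (e : ∀ i, X i) {B : ∀ i, Set (X i)} {C : ℕ → ∀ i, Set (X i)}
    (h : internalSet ω B ⊆ ⋃ n, internalSet ω (C n)) :
    ∃ N : ℕ, ∀ᶠ i in (ω : Filter ℕ), B i ⊆ ⋃ n ∈ Finset.range N, C n i := by
  by_contra! hcon
  obtain ⟨k, hk1, hk2⟩ := exists_diagonal hω
    (P := fun m i => ¬ B i ⊆ ⋃ n ∈ Finset.range m, C n i) hcon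
  -- A point of `B i` outside the first `k i - 1` sets; since `k` is unbounded along `ω`, its class
  -- escapes every `internalSet ω (C n)`.
  have hex : ∀ i, ∃ a : X i, k i ≠ 0 → a ∈ B i \ ⋃ n ∈ Finset.range (k i - 1), C n i := by
    intro i
    by_cases hi : k i = 0
    · exact ⟨e i, fun h => absurd hi h⟩
    · obtain ⟨a, ha⟩ := Set.not_subset.1 (hk1 i (k i - 1) (by omega))
      exact ⟨a, fun _ => ha⟩
  choose a ha using hex
  have haB : UltraProd.mk ω a ∈ internalSet ω B := by
    refine mk_mem_internalSet.2 ?_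
    filter_upwards [hk2 1] with i hi
    exact (ha i (by omega)).1
  obtain ⟨n, hn⟩ := Set.mem_iUnion.1 (h haB)
  obtain ⟨i, hi, hi'⟩ := ((mk_mem_internalSet.1 hn).and (hk2 (n + 2))).exists
  refine (ha i (by omega)).2 ?_
  simp only [Set.mem_iUnion, Finset.mem_range]
  exact ⟨n, by omega, hi⟩

variable [∀ i, MetricSpace (X i)] [∀ i, MeasurableSpace (X i)] [∀ i, BorelSpace (X i)] {p : ℝ}
  {ν : ∀ i, WassersteinSpace (X i) p}

theorem exists_loebPremeasure_eq (e : ∀ i, X i) (ν : ∀ i, WassersteinSpace (X i) p)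
    {B : ∀ i, Set (X i)} (hB : ∀ i, MeasurableSet (B i)) :
    ∃ L, loebPremeasure (UltraProd.mk ω ν) (internalSet ω B) = L ∧
      Tendsto (fun i => (ν i).toMeasure (B i)) ω (𝓝 L) := by
  have := fun i => (ν i).isProbabilityMeasure
  obtain ⟨L, hL, hlim⟩ := exists_tendsto_of_eventually_mem_Icc (ω := ω)
    (f := fun i => (ν i).toMeasure.real (B i)) (a := 0) (b := 1)
    (Eventually.of_forall fun i => ⟨measureReal_nonneg, measureReal_le_one⟩)
  refine ⟨ENNReal.ofReal L, ?_, ?_⟩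
  · rw [loebPremeasure_internalSet e _ hB]
    congr 1
    exact st_eq_of_tendsto hlim
  · have h := (ENNReal.continuous_ofReal.tendsto L).comp hlim
    refine h.congr fun i => ?_
    simp [Measure.real]

/-- With the standard part read as a limit along `ω`, additivity and subadditivity pass from the
factors to the premeasure. -/
theorem tendsto_loebPremeasure (e : ∀ i, X i) (ν : ∀ i, WassersteinSpace (X i) p)
    {B : ∀ i, Set (X i)} (hB : ∀ i, MeasurableSet (B i)) :
    Tendsto (fun i => (ν i).toMeasure (B i)) ω
      (𝓝 (loebPremeasure (UltraProd.mk ω ν) (internalSet ω B))) := by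
  obtain ⟨L, h, hL⟩ := exists_loebPremeasure_eq (ω := ω) e ν hB
  rwa [h]

theorem loebPremeasure_eq_top (μω : InternalMeasure ω X p) {S : Set (UltraProd ω X)}
    (h : ¬ ∃ B : ∀ i, Set (X i), (∀ i, MeasurableSet (B i)) ∧ internalSet ω B = S) :
    loebPremeasure μω S = ∞ := by
  simp only [loebPremeasure, iInf_eq_top]
  exact fun B hB hS => absurd ⟨B, hB, hS⟩ h

theorem measurableSet_internalSet (e : ∀ i, X i) (ν : ∀ i, WassersteinSpace (X i) p)
    {B : ∀ i, Set (X i)} (hB : ∀ i, MeasurableSet (B i)) :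
    MeasurableSet[loebSpace (UltraProd.mk ω ν)] (internalSet ω B) := by
  refine OuterMeasure.ofFunction_caratheodory fun T => ?_
  -- It suffices to test the premeasure, which is `∞` on sets that are not internal Borel.
  by_cases hT : ∃ C : ∀ i, Set (X i), (∀ i, MeasurableSet (C i)) ∧ internalSet ω C = T
  · obtain ⟨C, hC, rfl⟩ := hT
    rw [internalSet_inter, internalSet_diff]
    refine (tendsto_nhds_unique ((tendsto_loebPremeasure e ν fun i => (hC i).inter (hB i)).add
      (tendsto_loebPremeasure e ν fun i => (hC i).diff (hB i)))
      ((tendsto_loebPremeasure e ν hC).congr fun i => ?_)).le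
    rw [measure_inter_add_sdiff _ (hB i)]
  · rw [loebPremeasure_eq_top _ hT]
    exact le_top

/-- Saturation reduces a countable internal cover to a finite one in almost every factor, where
subadditivity applies; any other cover has infinite cost. -/
theorem loebPremeasure_le_loebOuterMeasure (hω : ∀ n : ℕ, ω ≠ pure n) (e : ∀ i, X i)
    (ν : ∀ i, WassersteinSpace (X i) p) {B : ∀ i, Set (X i)} (hB : ∀ i, MeasurableSet (B i)) :
    loebPremeasure (UltraProd.mk ω ν) (internalSet ω B) ≤
      loebOuterMeasure (UltraProd.mk ω ν) (internalSet ω B) := by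
  rw [loebOuterMeasure, OuterMeasure.ofFunction_apply]
  refine le_iInf₂ fun T hT => ?_
  by_cases hint : ∀ n, ∃ C : ∀ i, Set (X i), (∀ i, MeasurableSet (C i)) ∧ internalSet ω C = T n
  · choose C hC hCT using hint
    obtain rfl : (fun n => internalSet ω (C n)) = T := funext hCT
    obtain ⟨N, hN⟩ := eventually_subset_of_internalSet_subset_iUnion hω e hT
    refine le_trans ?_ (ENNReal.sum_le_tsum (Finset.range N))
    refine le_of_tendsto_of_tendsto (tendsto_loebPremeasure e ν hB)
      (tendsto_finsetSum _ fun n _ => tendsto_loebPremeasure e ν (hC n)) ?_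
    filter_upwards [hN] with i hi
    exact (measure_mono hi).trans (measure_biUnion_finset_le _ _)
  · push Not at hint
    obtain ⟨n, hn⟩ := hint
    have h : loebPremeasure (UltraProd.mk ω ν) (T n) = ∞ :=
      loebPremeasure_eq_top _ fun ⟨C, hC, h⟩ => hn C hC h
    rw [ENNReal.tsum_eq_top_of_eq_top ⟨n, h⟩]
    exact le_top

theorem loebMeasure_apply (μω : InternalMeasure ω X p) {S : Set (UltraProd ω X)}
    (hS : MeasurableSet[loebSpace μω] S) : loebMeasure μω S = loebOuterMeasure μω S :=
  @toMeasure_apply _ (loebSpace μω) _ le_rfl _ hS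

theorem loebMeasure_internalSet (hω : ∀ n : ℕ, ω ≠ pure n) (e : ∀ i, X i)
    (ν : ∀ i, WassersteinSpace (X i) p) {B : ∀ i, Set (X i)} (hB : ∀ i, MeasurableSet (B i)) :
    loebMeasure (UltraProd.mk ω ν) (internalSet ω B) =
      loebPremeasure (UltraProd.mk ω ν) (internalSet ω B) := by
  rw [loebMeasure_apply _ (measurableSet_internalSet e ν hB)]
  exact le_antisymm (OuterMeasure.ofFunction_le _)
    (loebPremeasure_le_loebOuterMeasure hω e ν hB)

theorem loebMeasure_univ (hω : ∀ n : ℕ, ω ≠ pure n) (e : ∀ i, X i)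
    (ν : ∀ i, WassersteinSpace (X i) p) : loebMeasure (UltraProd.mk ω ν) Set.univ = 1 := by
  have := fun i => (ν i).isProbabilityMeasure
  rw [← internalSet_univ, loebMeasure_internalSet hω e ν fun i => MeasurableSet.univ]
  refine tendsto_nhds_unique (tendsto_loebPremeasure e ν fun i => MeasurableSet.univ) ?_
  simp only [measure_univ, tendsto_const_nhds_iff]

/-- The Loeb space is complete. -/
theorem measurableSet_of_loebMeasure_null (μω : InternalMeasure ω X p) {S T : Set (UltraProd ω X)}
    (hT : loebMeasure μω T = 0) (hST : S ⊆ T) : MeasurableSet[loebSpace μω] S := by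
  have h : loebOuterMeasure μω S = 0 := by
    refine le_antisymm ?_ zero_le
    refine ((loebOuterMeasure μω).mono hST).trans ?_
    rw [← hT]
    exact @le_toMeasure_apply _ (loebSpace μω) _ le_rfl T
  refine (OuterMeasure.isCaratheodory_iff_le' _).2 fun T => ?_
  have h1 : loebOuterMeasure μω (T ∩ S) = 0 :=
    le_antisymm (((loebOuterMeasure μω).mono Set.inter_subset_right).trans h.le) zero_le
  rw [h1, zero_add]
  exact (loebOuterMeasure μω).mono Set.sdiff_subset

end LoebBasic


/-! ### The Loeb measure of a diagonal sequence of clouds -/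

section LoebClouds

open Topology

variable {ω : Ultrafilter ℕ} {X : ℕ → Type*} [∀ i, MetricSpace (X i)] {e : ∀ i, X i}

/-- The set `st⁻¹(A)`, as a subset of the whole ultraproduct. -/
def stPreimage (A : Set (UltraLimit ω e)) : Set (UltraProd ω X) :=
  (fun x : Limited ω e => x.1) '' ((stHat : Limited ω e → UltraLimit ω e) ⁻¹' A)

theorem Limited.coe_injective : Function.Injective fun x : Limited ω e => x.1 :=
  Subtype.val_injective

theorem mk_mem_stPreimage {A : Set (UltraLimit ω e)} {a : ∀ i, X i} :
    UltraProd.mk ω a ∈ stPreimage A ↔ ∃ t ∈ A, Represents a t := by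
  constructor
  · rintro ⟨⟨x, hx⟩, hA, rfl : x = _⟩
    exact ⟨_, hA, hx, rfl⟩
  · rintro ⟨_, hA, h, rfl⟩
    exact ⟨⟨_, h⟩, hA, rfl⟩

theorem stPreimage_univ : stPreimage (Set.univ : Set (UltraLimit ω e)) = limitedSet ω e := by
  refine (Set.image_univ (f := fun x : Limited ω e => x.1)).trans ?_
  exact Subtype.range_val

theorem stPreimage_mono {A B : Set (UltraLimit ω e)} (h : A ⊆ B) : stPreimage A ⊆ stPreimage B :=
  Set.image_mono (Set.preimage_mono h)

theorem disjoint_stPreimage {A B : Set (UltraLimit ω e)} (h : Disjoint A B) :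
    Disjoint (stPreimage A) (stPreimage B) :=
  (Set.disjoint_image_iff Limited.coe_injective).2 (h.preimage _)

/-- A chosen representative of a point of the ultralimit. -/
def rep (t : UltraLimit ω e) : ∀ i, X i := (exists_represents t).choose

theorem represents_rep (t : UltraLimit ω e) : Represents (rep t) t :=
  (exists_represents t).choose_spec

/-- The `δ`-neighbourhood of the representatives of the points of `F`. -/
def repThickening (δ : ℝ) (F : Set (UltraLimit ω e)) (i : ℕ) : Set (X i) :=
  Metric.thickening δ ((fun t => rep t i) '' F)

theorem mem_repThickening {δ : ℝ} {F : Set (UltraLimit ω e)} {i : ℕ} {y : X i} :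
    y ∈ repThickening δ F i ↔ ∃ t ∈ F, dist y (rep t i) < δ := by
  simp [repThickening, Metric.mem_thickening_iff]

/-- Because `F` is finite, the ultrafilter selects a single `t` that is close to `a i` for almost
all `i`. -/
theorem exists_of_mk_mem_internalSet {δ : ℝ} {F : Set (UltraLimit ω e)} (hF : F.Finite)
    {a : ∀ i, X i} (ha : UltraProd.mk ω a ∈ internalSet ω (repThickening δ F)) :
    ∃ s, Represents a s ∧ ∃ t ∈ F, dist s t ≤ δ := by
  have h := mk_mem_internalSet.1 ha
  simp only [mem_repThickening] at h
  obtain ⟨t, htF, ht⟩ := (Ultrafilter.eventually_exists_mem_iff hF).1 h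
  have hlim : UltraProd.mk ω a ∈ limitedSet ω e := by
    obtain ⟨r, hr⟩ := mk_mem_limitedSet_iff.1 (represents_rep t).choose
    refine mk_mem_limitedSet_iff.2 ⟨r + δ, ?_⟩
    filter_upwards [hr, ht] with i h1 h2
    rw [dist_comm] at h2
    exact (dist_triangle _ _ _).trans (add_le_add h1 h2.le)
  refine ⟨_, ⟨hlim, rfl⟩, t, htF, ?_⟩
  exact le_of_tendsto (Represents.tendsto_dist ⟨hlim, rfl⟩ (represents_rep t))
    (ht.mono fun i hi => hi.le)

theorem eventually_mem_repThickening {δ : ℝ} {F : Set (UltraLimit ω e)} {a : ∀ i, X i}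
    {s t : UltraLimit ω e} (ha : Represents a s) (ht : t ∈ F) (hst : dist s t < δ) :
    ∀ᶠ i in (ω : Filter ℕ), a i ∈ repThickening δ F i :=
  ((ha.tendsto_dist (represents_rep t)).eventually (gt_mem_nhds hst)).mono fun _ hi =>
    mem_repThickening.2 ⟨t, ht, hi⟩

/-- The preimage of a compact set under the standard part map is a decreasing countable
intersection of internal sets. -/
theorem exists_antitone_stPreimage_eq {K : Set (UltraLimit ω e)} (hK : IsCompact K) :
    ∃ (F : ℕ → Set (UltraLimit ω e)) (η : ℕ → ℝ), (∀ m, 0 < η m) ∧ (∀ m, (F m).Finite) ∧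
      (∀ m, K ⊆ ⋃ t ∈ F m, Metric.ball t (η m)) ∧
      (Antitone fun m => internalSet ω (repThickening (3 * η m) (F m))) ∧
      stPreimage K = ⋂ m, internalSet ω (repThickening (3 * η m) (F m)) := by
  -- Halving makes the thickenings decrease: `3 * η (m + 1)` plus the net distance `η m` is `5/2 * η
  -- m`, less than `3 * η m`.
  set η : ℕ → ℝ := fun m => (1 / 2) ^ m with hη
  have hη0 : ∀ m, 0 < η m := fun m => by positivity
  choose F hFK hF hKF using fun m => hK.finite_cover_balls (hη0 m)
  have hcov : ∀ m, ∀ s ∈ K, ∃ t ∈ F m, dist s t < η m := fun m s hs => by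
    simpa using hKF m hs
  refine ⟨F, η, hη0, hF, hKF, antitone_nat_of_succ_le fun m => ?_, ?_⟩
  · intro x hx
    obtain ⟨a, rfl⟩ := exists_mk_eq x
    obtain ⟨s, has, t, ht, hst⟩ := exists_of_mk_mem_internalSet (hF _) hx
    obtain ⟨t', ht', htt'⟩ := hcov m t (hFK _ ht)
    refine mk_mem_internalSet.2 (eventually_mem_repThickening has ht' ?_)
    have h1 : η (m + 1) = η m / 2 := by simp only [hη, pow_succ]; ring
    have := dist_triangle s t t'
    have := hη0 m
    rw [h1] at hst
    linarith
  · ext x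
    obtain ⟨a, rfl⟩ := exists_mk_eq x
    rw [mk_mem_stPreimage, Set.mem_iInter]
    constructor
    · rintro ⟨s, hs, has⟩ m
      obtain ⟨t, ht, hst⟩ := hcov m s hs
      refine mk_mem_internalSet.2 (eventually_mem_repThickening has ht ?_)
      linarith [hη0 m]
    · intro h
      obtain ⟨s, has, -⟩ := exists_of_mk_mem_internalSet (hF _) (h 0)
      refine ⟨s, ?_, has⟩
      rw [← hK.isClosed.closure_eq, Metric.mem_closure_iff]
      intro ε hε
      obtain ⟨m, hm⟩ := exists_pow_lt_of_lt_one (show 0 < ε / 3 by positivity)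
        (show (1 / 2 : ℝ) < 1 by norm_num)
      obtain ⟨s', has', t, ht, hst⟩ := exists_of_mk_mem_internalSet (hF _) (h m)
      obtain rfl : s = s' := by
        obtain ⟨_, rfl⟩ := has
        obtain ⟨_, rfl⟩ := has'
        rfl
      refine ⟨t, hFK _ ht, hst.trans_lt ?_⟩
      change (1 / 2 : ℝ) ^ m < ε / 3 at hm
      simp only [hη]
      linarith

variable [∀ i, MeasurableSpace (X i)] [∀ i, BorelSpace (X i)] {p : ℝ}

theorem cloudMeasure_le_cloudMeasure {Y Z : Type*} [MetricSpace Y] [MeasurableSpace Y]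
    [MetricSpace Z] [MeasurableSpace Z] {N : ℕ} {y : Fin N → Y} {z : Fin N → Z} {A : Set Y}
    {B : Set Z} (hA : MeasurableSet A) (hB : MeasurableSet B) (h : ∀ j, y j ∈ A → z j ∈ B) :
    cloudMeasure y A ≤ cloudMeasure z B := by
  simp only [cloudMeasure, Measure.smul_apply, Measure.coe_finsetSum, Finset.sum_apply,
    Measure.dirac_apply' _ hA, Measure.dirac_apply' _ hB, smul_eq_mul]
  gcongr with j
  by_cases hj : y j ∈ A
  · simp [hj, h j hj]
  · simp [hj]

section

variable {μ : WassersteinSpace (UltraLimit ω e) p} {N : ℕ → ℕ} [∀ n, NeZero (N n)]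
  {x : ∀ n, Fin (N n) → ∀ i, X i} {s : ∀ n, Fin (N n) → UltraLimit ω e} {k : ℕ → ℕ}

/-- Three radii add up: `K` is within `η` of `F`, passing to `s n` costs another `η`, and passing
from `x n` to the diagonal cloud a third. By Markov the mass escaping these bounds vanishes as `n →
∞`. -/
theorem IsDiagonalApproximation.measure_le_loebPremeasure (hp : 1 ≤ p)
    (h : IsDiagonalApproximation μ x s k)
    {K F : Set (UltraLimit ω e)} (hK : IsClosed K) {η : ℝ}
    (hη : 0 < η) (hKF : K ⊆ ⋃ t ∈ F, Metric.ball t η) :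
    μ.toMeasure K ≤ loebPremeasure (UltraProd.mk ω fun i => cloud p hp fun j => x (k i) j i)
      (internalSet ω (repThickening (3 * η) F)) := by
  obtain ⟨hx, hs, hk⟩ := h
  have hp0 : 0 < p := by linarith
  have hlim : ∀ c : ℝ, Tendsto (fun n : ℕ => ENNReal.ofReal (c / ((n : ℝ) + 1) / η) ^ p)
      atTop (𝓝 0) := fun c => by
    have h1 : Tendsto (fun n : ℕ => c / ((n : ℝ) + 1) / η) atTop (𝓝 0) := by
      have := (tendsto_one_div_add_atTop_nhds_zero_nat (𝕜 := ℝ)).const_mul (c / η)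
      rw [mul_zero] at this
      exact this.congr fun n => by ring
    have h2 := (ENNReal.continuous_rpow_const (y := p)).tendsto _ |>.comp
      ((ENNReal.continuous_ofReal.tendsto _).comp h1)
    rwa [ENNReal.ofReal_zero, ENNReal.zero_rpow_of_pos hp0] at h2
  set L := loebPremeasure (UltraProd.mk ω fun i => cloud p hp fun j => x (k i) j i)
      (internalSet ω (repThickening (3 * η) F)) with hL
  have hopen : ∀ δ i, MeasurableSet (repThickening δ F i) := fun δ i =>
    Metric.isOpen_thickening.measurableSet
  have key : ∀ n : ℕ, μ.toMeasure K ≤ L + (ENNReal.ofReal (2 / ((n : ℝ) + 1) / η) ^ p +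
      ENNReal.ofReal (1 / ((n : ℝ) + 1) / η) ^ p) := by
    intro n
    have h1 := measure_le_thickening hp hη
      (transportCost_lt_of_lt hp (transportCost_cloud_ne_top hp μ _) (hs n)) hK.measurableSet
    have h2 : ∀ᶠ i in (ω : Filter ℕ), ∀ j, s n j ∈ Metric.thickening η K →
        x n j i ∈ repThickening (2 * η) F i := by
      refine eventually_all.2 fun j => ?_
      by_cases hj : s n j ∈ Metric.thickening η K
      · obtain ⟨z, hz, hjz⟩ := Metric.mem_thickening_iff.1 hj
        obtain ⟨t, ht, hzt⟩ : ∃ t ∈ F, dist z t < η := by simpa using hKF hz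
        refine (eventually_mem_repThickening (δ := 2 * η) (hx n j) ht ?_).mono fun i hi _ => hi
        linarith [dist_triangle (s n j) z t]
      · exact Eventually.of_forall fun i h => absurd h hj
    refine ge_of_tendsto ((tendsto_loebPremeasure e _ (hopen (3 * η))).add_const _) ?_
    filter_upwards [h2, hk n] with i h2 h3
    have h4 := measure_le_thickening hp hη (transportCost_lt_of_lt hp
      (transportCost_cloud_ne_top hp (cloud p hp fun j => x n j i) _) h3) (hopen (2 * η) i)
    have h5 : Metric.thickening η (repThickening (2 * η) F i) ⊆ repThickening (3 * η) F i := by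
      refine (Metric.thickening_thickening_subset _ _ _).trans_eq ?_
      rw [repThickening]
      congr 1
      ring
    calc μ.toMeasure K ≤ _ := h1
      _ ≤ cloudMeasure (fun j => x n j i) (repThickening (2 * η) F i) +
          ENNReal.ofReal (1 / ((n : ℝ) + 1) / η) ^ p := by
        gcongr
        exact cloudMeasure_le_cloudMeasure Metric.isOpen_thickening.measurableSet (hopen _ _) h2
      _ ≤ (cloudMeasure (fun j => x (k i) j i) (repThickening (3 * η) F i) +
          ENNReal.ofReal (2 / ((n : ℝ) + 1) / η) ^ p) +
          ENNReal.ofReal (1 / ((n : ℝ) + 1) / η) ^ p := by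
        gcongr
        exact h4.trans (add_le_add_left (measure_mono h5) _)
      _ = _ := add_assoc _ _ _
  have := (((hlim 2).add (hlim 1)).const_add L)
  rw [add_zero, add_zero] at this
  exact ge_of_tendsto' this key

/-- Continuity from above along the internal thickenings, valid since the Loeb measure is finite. -/
theorem IsDiagonalApproximation.measure_le_loebMeasure_stPreimage
    (hω : ∀ n : ℕ, ω ≠ pure n) (hp : 1 ≤ p)
    (h : IsDiagonalApproximation μ x s k) {K : Set (UltraLimit ω e)} (hK : IsCompact K) :
    MeasurableSet[loebSpace (UltraProd.mk ω fun i => cloud p hp fun j => x (k i) j i)]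
      (stPreimage K) ∧
    μ.toMeasure K ≤ loebMeasure (UltraProd.mk ω fun i => cloud p hp fun j => x (k i) j i)
      (stPreimage K) := by
  set ν : ∀ i, WassersteinSpace (X i) p := fun i => cloud p hp fun j => x (k i) j i with hν
  let _ : MeasurableSpace (UltraProd ω X) := loebSpace (UltraProd.mk ω ν)
  obtain ⟨F, η, hη, hF, hKF, hanti, heq⟩ := exists_antitone_stPreimage_eq hK
  have hopen : ∀ m i, MeasurableSet (repThickening (3 * η m) (F m) i) := fun m i =>
    Metric.isOpen_thickening.measurableSet
  have hmeas : ∀ m, MeasurableSet (internalSet ω (repThickening (3 * η m) (F m))) := fun m =>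
    measurableSet_internalSet e ν (hopen m)
  have hfin : loebMeasure (UltraProd.mk ω ν)
      (internalSet ω (repThickening (3 * η 0) (F 0))) ≠ ∞ :=
    ne_top_of_le_ne_top (by rw [loebMeasure_univ hω e ν]; exact ENNReal.one_ne_top)
      (measure_mono (Set.subset_univ _))
  rw [heq]
  refine ⟨MeasurableSet.iInter hmeas, ?_⟩
  refine ge_of_tendsto' (tendsto_measure_iInter_atTop
    (fun m => (hmeas m).nullMeasurableSet) hanti ⟨0, hfin⟩) fun m => ?_
  refine (h.measure_le_loebPremeasure hp hK.isClosed (hη m) (hKF m)).trans_eq ?_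
  exact (loebMeasure_internalSet hω e ν (hopen m)).symm

/-- Compact sets inside `A` and `Aᶜ` give disjoint measurable `S` and `T`, inside the two preimages,
with masses at least `μ(A)` and `μ(Aᶜ)`. These add up to one, so `S ∪ T` has full measure and
`stPreimage A` differs from `S` by a null set. -/
theorem IsDiagonalApproximation.loebMeasure_stPreimage (hω : ∀ n : ℕ, ω ≠ pure n) (hp : 1 ≤ p)
    (h : IsDiagonalApproximation μ x s k)
    {A : Set (UltraLimit ω e)} (hA : MeasurableSet A) :
    MeasurableSet[loebSpace (UltraProd.mk ω fun i => cloud p hp fun j => x (k i) j i)]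
      (stPreimage A) ∧
    loebMeasure (UltraProd.mk ω fun i => cloud p hp fun j => x (k i) j i) (stPreimage A) =
      μ.toMeasure A := by
  have hcpt := fun K => h.measure_le_loebMeasure_stPreimage hω hp (K := K)
  set ν : ∀ i, WassersteinSpace (X i) p := fun i => cloud p hp fun j => x (k i) j i with hν
  let _ : MeasurableSpace (UltraProd ω X) := loebSpace (UltraProd.mk ω ν)
  set P := loebMeasure (UltraProd.mk ω ν) with hP
  have hP1 : P Set.univ = 1 := loebMeasure_univ hω e ν
  have := μ.isProbabilityMeasure
  have := μ.innerRegular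
  have : IsProbabilityMeasure P := ⟨hP1⟩
  have inner : ∀ A : Set (UltraLimit ω e), MeasurableSet A →
      ∃ S ⊆ stPreimage A, MeasurableSet S ∧ μ.toMeasure A ≤ P S := by
    intro A hA
    have hK : ∀ n : ℕ, ∃ K ⊆ A, IsCompact K ∧
        μ.toMeasure A < μ.toMeasure K + (n : ℝ≥0∞)⁻¹ := fun n =>
      hA.exists_isCompact_lt_add (measure_ne_top _ _) (by simp)
    choose K hKA hKc hK using hK
    refine ⟨⋃ n, stPreimage (K n), Set.iUnion_subset fun n => stPreimage_mono (hKA n),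
      MeasurableSet.iUnion fun n => (hcpt _ (hKc n)).1, ?_⟩
    have hlim := ENNReal.tendsto_inv_nat_nhds_zero.const_add (P (⋃ n, stPreimage (K n)))
    rw [add_zero] at hlim
    refine ge_of_tendsto' hlim fun n => (hK n).le.trans ?_
    gcongr
    exact (hcpt _ (hKc n)).2.trans (measure_mono (Set.subset_iUnion (fun n => stPreimage (K n)) n))
  obtain ⟨S, hSA, hS, hμS⟩ := inner A hA
  obtain ⟨T, hTA, hT, hμT⟩ := inner Aᶜ hA.compl
  have hdisj : Disjoint (stPreimage A) T :=
    (disjoint_stPreimage disjoint_compl_right).mono_right hTA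
  have hsum : μ.toMeasure A + μ.toMeasure Aᶜ = 1 := by
    rw [measure_add_measure_compl hA, measure_univ]
  have hST : P (S ∪ T) = P S + P T := measure_union (hdisj.mono_left hSA) hT
  have hST1 : P (S ∪ T) = 1 :=
    le_antisymm prob_le_one (by rw [hST, ← hsum]; exact add_le_add hμS hμT)
  have hnull : P (S ∪ T)ᶜ = 0 := (prob_compl_eq_zero_iff (hS.union hT)).2 hST1
  have hsub : stPreimage A \ S ⊆ (S ∪ T)ᶜ := by
    rintro y ⟨hy, hyS⟩ (h' | h')
    · exact hyS h'
    · exact Set.disjoint_left.1 hdisj hy h'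
  have hdiff : MeasurableSet (stPreimage A \ S) := measurableSet_of_loebMeasure_null _ hnull hsub
  have hmeas : MeasurableSet (stPreimage A) := by
    rw [← Set.union_sdiff_cancel hSA]
    exact hS.union hdiff
  refine ⟨hmeas, le_antisymm ?_ (hμS.trans (measure_mono hSA))⟩
  have h1 : P (stPreimage A) + P T ≤ μ.toMeasure A + P T :=
    calc P (stPreimage A) + P T = P (stPreimage A ∪ T) := (measure_union hdisj hT).symm
      _ ≤ 1 := prob_le_one
      _ = μ.toMeasure A + μ.toMeasure Aᶜ := hsum.symm
      _ ≤ μ.toMeasure A + P T := by gcongr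
  exact (ENNReal.add_le_add_iff_right (measure_ne_top P T)).1 h1

theorem IsDiagonalApproximation.loebMeasure_compl_limitedSet (hω : ∀ n : ℕ, ω ≠ pure n) (hp : 1 ≤ p)
    (h : IsDiagonalApproximation μ x s k) :
    loebMeasure (UltraProd.mk ω fun i => cloud p hp fun j => x (k i) j i) (limitedSet ω e)ᶜ = 0 := by
  have := μ.isProbabilityMeasure
  obtain ⟨h1, h2⟩ := h.loebMeasure_stPreimage hω hp MeasurableSet.univ
  have hu := loebMeasure_univ hω e fun i => cloud p hp fun j => x (k i) j i
  rw [stPreimage_univ] at h1 h2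
  let _ : MeasurableSpace (UltraProd ω X) :=
    loebSpace (UltraProd.mk ω fun i => cloud p hp fun j => x (k i) j i)
  rw [measure_compl h1 (by rw [h2]; exact measure_ne_top _ _), h2, hu, measure_univ, tsub_self]

theorem IsDiagonalApproximation.measurePreserving_stHat (hω : ∀ n : ℕ, ω ≠ pure n) (hp : 1 ≤ p)
    (h : IsDiagonalApproximation μ x s k) :
    @MeasurePreserving (Limited ω e) (UltraLimit ω e)
      (loebSpaceLim e (UltraProd.mk ω fun i => cloud p hp fun j => x (k i) j i)) _ stHat
      (loebMeasureLim e (UltraProd.mk ω fun i => cloud p hp fun j => x (k i) j i))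
      μ.toMeasure := by
  have hst := fun A => h.loebMeasure_stPreimage hω hp (A := A)
  set μω : InternalMeasure ω X p := UltraProd.mk ω fun i => cloud p hp fun j => x (k i) j i
  let _ : MeasurableSpace (UltraProd ω X) := loebSpace μω
  let _ : MeasurableSpace (Limited ω e) := loebSpaceLim e μω
  have hlim : MeasurableSet (limitedSet ω e) := by
    rw [← stPreimage_univ]
    exact (hst _ MeasurableSet.univ).1
  -- `Measure.comap` is computed by images only when these are measurable, which holds because
  -- `limitedSet` is Loeb measurable.
  have himage : ∀ A : Set (Limited ω e), MeasurableSet A →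
      MeasurableSet (Subtype.val '' A : Set (UltraProd ω X)) := by
    rintro _ ⟨S, hS, rfl⟩
    have : (Subtype.val '' (Subtype.val ⁻¹' S : Set (Limited ω e)) : Set (UltraProd ω X)) =
        limitedSet ω e ∩ S := Subtype.image_preimage_coe _ _
    rw [this]
    exact hlim.inter hS
  have hmeas : Measurable (stHat : Limited ω e → UltraLimit ω e) := fun A hA =>
    ⟨stPreimage A, (hst A hA).1, Set.preimage_image_eq _ Limited.coe_injective⟩
  refine ⟨hmeas, ?_⟩
  ext A hA
  rw [Measure.map_apply hmeas hA]
  exact (Measure.comap_apply (fun x : Limited ω e => x.1) Limited.coe_injective himage _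
    (hmeas hA)).trans (hst A hA).2

end

end LoebClouds

/-! ### The lifting theorem -/

theorem isHyperfinite_mk_cloud {ω : Ultrafilter ℕ} {X : ℕ → Type*} [∀ i, MetricSpace (X i)]
    [∀ i, MeasurableSpace (X i)] [∀ i, BorelSpace (X i)] {p : ℝ} (hp : 1 ≤ p) {N : ℕ → ℕ}
    [∀ i, NeZero (N i)] (x : ∀ i, Fin (N i) → X i) :
    IsHyperfinite (UltraProd.mk ω fun i => cloud p hp (x i)) := by
  classical
  refine ⟨_, rfl, fun i => ⟨Finset.univ.image (x i), ?_⟩⟩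
  change cloudMeasure (x i) _ = 0
  simp [cloudMeasure]

end UltraWasserstein

end

theorem mainTheorem3 {X : ℕ → Type*} [∀ i, MetricSpace (X i)] [∀ i, MeasurableSpace (X i)]
    [∀ i, BorelSpace (X i)] (e : ∀ i, X i) (ω : Ultrafilter ℕ) (hω : ∀ n : ℕ, ω ≠ pure n)
    (p : ℝ) (hp : 1 ≤ p)
    (μ : UltraWasserstein.WassersteinSpace (UltraWasserstein.UltraLimit ω e) p) :
    ∃ μω : UltraWasserstein.InternalMeasure ω X p,
      UltraWasserstein.IsHyperfinite μω ∧
      UltraWasserstein.IsLifting hp e μω μ ∧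
      UltraWasserstein.loebMeasure μω (UltraWasserstein.limitedSet ω e)ᶜ = 0 ∧
      @MeasurePreserving (UltraWasserstein.Limited ω e) (UltraWasserstein.UltraLimit ω e)
        (UltraWasserstein.loebSpaceLim e μω) _ UltraWasserstein.stHat
        (UltraWasserstein.loebMeasureLim e μω) μ.toMeasure := by
  obtain ⟨N, _, x, s, k, h⟩ := UltraWasserstein.exists_isDiagonalApproximation hω hp μ
  exact ⟨UltraWasserstein.UltraProd.mk ω fun i =>
      UltraWasserstein.cloud p hp fun j => x (k i) j i,
    UltraWasserstein.isHyperfinite_mk_cloud hp _, h.isLifting hp,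
    h.loebMeasure_compl_limitedSet hω hp, h.measurePreserving_stHat hω hp⟩
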